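/- Let $\mathbb F\in\{\mathbb R,\mathbb C\}$, and put $\alpha:=1$ if $\mathbb F=\mathbb R$ and $\alpha:=0$ if $\mathbb F=\mathbb C$. Let $f(s,t):=s/(t-s-\alpha)$. For a matrix $A$ with entries in $\mathbb F$ and $j\ge 1$ define the tail energy $\tau_j^2(A):=\min_{\operatorname{rank}(B)<j}\|A-B\|_F^2$, where $\|\cdot\|_F$ is the Frobenius norm. A real standard normal matrix has independent $N(0,1)$ entries; a complex one is $G_1+\mathrm iG_2$ with $G_1,G_2$ independent real standard normal matrices. Let $A\in\mathbb F^{n\times n}$ be conjugate symmetric ($A=A^*$), and let $k\le n$ and $\ell>k+\alpha$ be natural numbers. Let $\Omega\in\mathbb F^{n\times k}$ and $\Psi\in\mathbb F^{\ell\times n}$ be independent standard normal matrices. Form the sketches $Y=A\Omega$ and $W=\Psi A$. Let $Y=QR$ be an orthogonal–triangular factorization, where $Q\in\mathbb F^{n\times k}$ has orthonormal columns and is a fixed measurable function of $Y$. Put $X=(\Psi Q)^\dagger W$, where $\dagger$ is the Moore–Penrose pseudoinverse, let $\hat A=QX$, and let $$\hat A_{\rm sym}:=\tfrac12(\hat A+\hat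 A^*)=\tfrac12(QX+X^*Q^*).$$ Then: (i) $\hat A_{\rm sym}$ is the Frobenius-norm projection of $\hat A$ onto the set of conjugate symmetric $n\times n$ matrices (the unique closest point), and $\operatorname{rank}\hat A_{\rm sym}\le 2k$. Moreover $\hat A_{\rm sym}=USU^*$ whenever $[\,Q\ \ X^*\,]=U[\,T_1\ \ T_2\,]$ is an orthogonal–triangular factorization, where $T_1$ and $T_2$ have $k$ columns each, and $S=\tfrac12(T_1T_2^*+T_2T_1^*)$. (ii) The random variable $\|A-\hat A_{\rm sym}\|_F^2$ is integrable, and if $k>\alpha$, then $$\mathbb E\,\|A-\hat A_{\rm sym}\|_F^2\le (1+f(k,\ell))\cdot\min_{\varrho<k-\alpha}(1+f(\varrho,k))\cdot\tau_{\varrho+1}^2(A),$$ where $\varrho$ ranges over the natural numbers $0,1,2,\dots$ less than $k-\alpha$. -/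

import Mathlib

open MeasureTheory ProbabilityTheory Matrix

noncomputable section

namespace LowRankSketch

/-- The number `α(𝕜)`: it is `1` for the real field (where `RCLike.I = 0`) and `0` for the
complex field. -/
def alpha (𝕜 : Type*) [RCLike 𝕜] : ℕ :=
  open Classical in if (RCLike.I : 𝕜) = 0 then 1 else 0

/-- The function `f(s, t) = s / (t - s - α)`, used for `t > s + α`. -/
def fRatio (𝕜 : Type*) [RCLike 𝕜] (s t : ℕ) : ℝ :=
  (s : ℝ) / ((t : ℝ) - (s : ℝ) - (alpha 𝕜 : ℝ))

/-- The squared Frobenius norm. -/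
def frobSq {𝕜 : Type*} [RCLike 𝕜] {m n : ℕ} (M : Matrix (Fin m) (Fin n) 𝕜) : ℝ :=
  ∑ i, ∑ j, ‖M i j‖ ^ 2

/-- The tail energy `τ_j²(A)`, i.e. the least squared Frobenius error of approximation of `A`
by a matrix of rank less than `j`, for `j ≥ 1`. -/
def tailEnergySq {𝕜 : Type*} [RCLike 𝕜] {m n : ℕ} (j : ℕ) (A : Matrix (Fin m) (Fin n) 𝕜) : ℝ :=
  sInf {x : ℝ | ∃ B : Matrix (Fin m) (Fin n) 𝕜, B.rank < j ∧ x = frobSq (A - B)}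

/-! ### Standard normal matrices -/

/-- The product σ-algebra on matrices. -/
instance matrixMeasurableSpace {m n R : Type*} [MeasurableSpace R] :
    MeasurableSpace (Matrix m n R) :=
  inferInstanceAs (MeasurableSpace (m → n → R))

/-- A real standard normal random matrix: independent entries of law `N(0, 1)`. -/
structure IsRealStdNormal {S : Type*} [MeasurableSpace S] {m n : ℕ}
    (G : S → Matrix (Fin m) (Fin n) ℝ) (P : Measure S) : Prop where
  indep : iIndepFun (fun (p : Fin m × Fin n) (s : S) => G s p.1 p.2) P
  law : ∀ i j, HasLaw (fun s => G s i j) (gaussianReal 0 1) P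

/-- A standard normal random matrix over `𝕜`. Over `ℝ` this is a real standard normal matrix;
over `ℂ` the real and imaginary parts are independent real standard normal matrices. -/
structure IsStdNormal {𝕜 : Type*} [RCLike 𝕜] {S : Type*} [MeasurableSpace S] {m n : ℕ}
    (G : S → Matrix (Fin m) (Fin n) 𝕜) (P : Measure S) : Prop where
  re : IsRealStdNormal (fun s => (G s).map RCLike.re) P
  im : (RCLike.I : 𝕜) ≠ 0 → IsRealStdNormal (fun s => (G s).map RCLike.im) P
  indep : (RCLike.I : 𝕜) ≠ 0 →
    IndepFun (fun s => (G s).map (RCLike.re : 𝕜 → ℝ)) (fun s => (G s).map (RCLike.im : 𝕜 → ℝ)) P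

/-! ### Orthogonal–triangular factorization and the Moore–Penrose pseudoinverse -/

/-- `Y = Q R` is a (thin) orthogonal–triangular factorization: the `p` columns of `Q` are
orthonormal and `R` is upper triangular (upper trapezoidal if it is not square). -/
structure IsQR {𝕜 : Type*} [RCLike 𝕜] {m p s : ℕ} (Y : Matrix (Fin m) (Fin s) 𝕜)
    (Q : Matrix (Fin m) (Fin p) 𝕜) (R : Matrix (Fin p) (Fin s) 𝕜) : Prop where
  orthonormal : Qᴴ * Q = 1
  upper : ∀ (i : Fin p) (j : Fin s), (j : ℕ) < (i : ℕ) → R i j = 0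
  factor : Y = Q * R

/-- The four Penrose equations: `P` is the Moore–Penrose pseudoinverse of `M`. -/
structure IsMoorePenrose {𝕜 : Type*} [RCLike 𝕜] {m n : ℕ}
    (M : Matrix (Fin m) (Fin n) 𝕜) (P : Matrix (Fin n) (Fin m) 𝕜) : Prop where
  mul_mul : M * P * M = M
  mul_mul' : P * M * P = P
  left : (M * P)ᴴ = M * P
  right : (P * M)ᴴ = P * M

theorem exists_isMoorePenrose {𝕜 : Type*} [RCLike 𝕜] {m n : ℕ}
    (M : Matrix (Fin m) (Fin n) 𝕜) : ∃ P, IsMoorePenrose M P := by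
  have hH : (Mᴴ * M).IsHermitian := isHermitian_conjTranspose_mul_self M
  obtain ⟨K, hK, h1, h2, h3⟩ : ∃ K : Matrix (Fin n) (Fin n) 𝕜, Kᴴ = K ∧
      (Mᴴ * M) * K = K * (Mᴴ * M) ∧ (Mᴴ * M) * K * (Mᴴ * M) = Mᴴ * M ∧
      K * (Mᴴ * M) * K = K := by
    set U : Matrix (Fin n) (Fin n) 𝕜 := (hH.eigenvectorUnitary : Matrix (Fin n) (Fin n) 𝕜)
    set D : Fin n → 𝕜 := RCLike.ofReal ∘ hH.eigenvalues
    have hU : Uᴴ * U = 1 := Unitary.coe_star_mul_self hH.eigenvectorUnitary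
    have hs : Mᴴ * M = U * diagonal D * Uᴴ := by
      have := hH.spectral_theorem
      rwa [Unitary.conjStarAlgAut_apply] at this
    have key : ∀ d e : Fin n → 𝕜, U * diagonal d * Uᴴ * (U * diagonal e * Uᴴ) =
        U * diagonal (fun i => d i * e i) * Uᴴ := by
      intro d e
      calc _ = U * diagonal d * (Uᴴ * U) * diagonal e * Uᴴ := by simp only [Matrix.mul_assoc]
        _ = _ := by rw [hU, Matrix.mul_one, Matrix.mul_assoc U, diagonal_mul_diagonal]
    refine ⟨U * diagonal (fun i => (D i)⁻¹) * Uᴴ, ?_, ?_, ?_, ?_⟩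
    · have hstar : star (fun i => (D i)⁻¹) = fun i => (D i)⁻¹ := by
        funext i; simp [D]
      rw [conjTranspose_mul, conjTranspose_mul, conjTranspose_conjTranspose,
        diagonal_conjTranspose, hstar, Matrix.mul_assoc]
    · rw [hs, key, key]; simp only [mul_comm]
    · rw [hs, key, key]; congr 3; funext i; by_cases h : D i = 0 <;> simp [h]
    · rw [hs, key, key]
      congr 3; funext i; by_cases h : D i = 0 <;> simp [h]
  refine ⟨K * Mᴴ, ?_, ?_, ?_, ?_⟩
  · have h : Mᴴ * M * (K * (Mᴴ * M) - 1) = 0 := by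
      rw [Matrix.mul_sub, Matrix.mul_one, ← Matrix.mul_assoc, h2, sub_self]
    open ComplexOrder in
    rw [conjTranspose_mul_self_mul_eq_zero, Matrix.mul_sub, Matrix.mul_one, sub_eq_zero] at h
    simpa only [Matrix.mul_assoc] using h
  · calc _ = K * (Mᴴ * M) * K * Mᴴ := by simp only [Matrix.mul_assoc]
      _ = _ := by rw [h3]
  · simp only [conjTranspose_mul, conjTranspose_conjTranspose, hK, Matrix.mul_assoc]
  · rw [Matrix.mul_assoc, conjTranspose_mul, hK, conjTranspose_mul, conjTranspose_conjTranspose, h1]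

theorem IsMoorePenrose.unique {𝕜 : Type*} [RCLike 𝕜] {m n : ℕ}
    {M : Matrix (Fin m) (Fin n) 𝕜} {P P' : Matrix (Fin n) (Fin m) 𝕜}
    (h : IsMoorePenrose M P) (h' : IsMoorePenrose M P') : P = P' := by
  have e1 : M * P = M * P' := by
    calc M * P = (M * P)ᴴ := h.left.symm
      _ = (M * P' * (M * P))ᴴ := by rw [← Matrix.mul_assoc, h'.mul_mul]
      _ = M * P * (M * P') := by rw [conjTranspose_mul, h.left, h'.left]
      _ = M * P' := by rw [← Matrix.mul_assoc, h.mul_mul]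
  have e2 : P * M = P' * M := by
    calc P * M = (P * M)ᴴ := h.right.symm
      _ = (P * M * (P' * M))ᴴ := by rw [Matrix.mul_assoc, ← Matrix.mul_assoc M, h'.mul_mul]
      _ = P' * M * (P * M) := by rw [conjTranspose_mul, h.right, h'.right]
      _ = P' * M := by rw [Matrix.mul_assoc, ← Matrix.mul_assoc M, h.mul_mul]
  calc P = P * M * P := h.mul_mul'.symm
    _ = P' * M * P' := by rw [e2, Matrix.mul_assoc, e1, Matrix.mul_assoc]
    _ = P' := h'.mul_mul'

/-- The Moore–Penrose pseudoinverse. -/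
def pinv {𝕜 : Type*} [RCLike 𝕜] {m n : ℕ} (M : Matrix (Fin m) (Fin n) 𝕜) :
    Matrix (Fin n) (Fin m) 𝕜 :=
  (exists_isMoorePenrose M).choose

/-! ### The approximations -/

/-- The factor `X = (Ψ Q)† W`, where `W = Ψ A` is the co-range sketch. -/
def factorX {𝕜 : Type*} [RCLike 𝕜] {m n k l : ℕ} (Q : Matrix (Fin m) (Fin k) 𝕜)
    (Psi : Matrix (Fin l) (Fin m) 𝕜) (W : Matrix (Fin l) (Fin n) 𝕜) :
    Matrix (Fin k) (Fin n) 𝕜 :=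
  pinv (Psi * Q) * W

/-- The conjugate symmetric part `(M + M*) / 2`. -/
def symPart {𝕜 : Type*} [RCLike 𝕜] {n : ℕ} (M : Matrix (Fin n) (Fin n) 𝕜) :
    Matrix (Fin n) (Fin n) 𝕜 :=
  (1 / 2 : 𝕜) • (M + Mᴴ)

/-- `N` is the Frobenius-norm projection of `M` onto the set `C`: the unique point of `C` that
is closest to `M`. -/
def IsFrobProj {𝕜 : Type*} [RCLike 𝕜] {m n : ℕ} (C : Set (Matrix (Fin m) (Fin n) 𝕜))
    (M N : Matrix (Fin m) (Fin n) 𝕜) : Prop :=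
  N ∈ C ∧ ∀ B ∈ C, B ≠ N → frobSq (N - M) < frobSq (B - M)

/-- The symmetric approximation `(Q X + X* Q*) / 2`. -/
def symApprox {𝕜 : Type*} [RCLike 𝕜] {n k : ℕ} (Q : Matrix (Fin n) (Fin k) 𝕜)
    (X : Matrix (Fin k) (Fin n) 𝕜) : Matrix (Fin n) (Fin n) 𝕜 :=
  symPart (Q * X)

/-- The horizontal concatenation `[Q, X*]`. -/
def concatQX {𝕜 : Type*} [RCLike 𝕜] {n k : ℕ} (Q : Matrix (Fin n) (Fin k) 𝕜)
    (X : Matrix (Fin k) (Fin n) 𝕜) : Matrix (Fin n) (Fin (k + k)) 𝕜 :=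
  Matrix.of fun i => Fin.append (Q i) (Xᴴ i)

/-- The core matrix `S = (T₁ T₂* + T₂ T₁*) / 2`, where `T = [T₁, T₂]`. -/
def coreS {𝕜 : Type*} [RCLike 𝕜] {k p : ℕ} (T : Matrix (Fin p) (Fin (k + k)) 𝕜) :
    Matrix (Fin p) (Fin p) 𝕜 :=
  (1 / 2 : 𝕜) • (T.submatrix id (Fin.castAdd k) * (T.submatrix id (Fin.natAdd k))ᴴ +
    T.submatrix id (Fin.natAdd k) * (T.submatrix id (Fin.castAdd k))ᴴ)

end LowRankSketch

end

open LowRankSketch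

namespace LowRankSketch

variable {𝕜 : Type*} [RCLike 𝕜]

/-! ### The real Frobenius inner product -/

/-! The proof is Pythagoras for the Frobenius norm combined with the rotation invariance of Gaussian
matrices. Since `A = A*`, projecting `Q X` onto the conjugate symmetric matrices cannot increase its
distance to `A` (`frobSq_sub_eq_symPart`), so it is enough to bound `A - Q X`.

Fix `Ω`, hence `Q`, and put `E = A - Q Q* A`. Almost surely `(Ψ Q)†` is a left inverse of `Ψ Q`, so
`A - Q X = E - Q (Ψ Q)† Ψ E`, a sum of two orthogonal terms (`frobSq_sub_oblique`). The ranges of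
`Q` and `E` are orthogonal, so `Ψ Q` and `Ψ E` are independent, and the second term has mean square
at most `f(k, ℓ) ‖E‖²`. This gives the factor `1 + f(k, ℓ)`.

Next, `A Ω = Q R` makes `‖E‖` at most `‖A - A Ω Z‖` for every `Z`. Given `B` of rank at most `r`,
let `V` span its row space. A suitable `Z` turns the adjoint of `A - A Ω Z` into the error of the
same oblique projection, now with `V` and the sketch `Ω*`. The same estimate yields `(1 + f(r, k))
‖A - B‖²` (`lintegral_range_finder_le`); it remains to take the infimum over `B` and the minimum
over `r`.

The probabilistic core is `E ‖G†‖² ≤ k / (β (m - k - α))` for an `m × k` standard normal `G`, with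
`β` the real dimension of the field (`lintegral_frobSq_gramPinv_le`). Each row of `G†` is bounded by
the inverse distance of a column to the span of the others. Given those others, its square is
dominated by an inverse chi-squared variable, whose mean comes from integrating a Laplace transform.
-/

instance matrixBorelSpace {m n R : Type*} [Countable m] [Countable n] [TopologicalSpace R]
    [SecondCountableTopology R] [MeasurableSpace R] [BorelSpace R] : BorelSpace (Matrix m n R) :=
  inferInstanceAs (BorelSpace (m → n → R))

instance matrixSecondCountable {m n R : Type*} [Countable m] [Countable n] [TopologicalSpace R]
    [SecondCountableTopology R] : SecondCountableTopology (Matrix m n R) :=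
  inferInstanceAs (SecondCountableTopology (m → n → R))

/-- The real inner product on matrices that induces the Frobenius norm. -/
noncomputable def frobInner {m n : ℕ} (T M : Matrix (Fin m) (Fin n) 𝕜) : ℝ :=
  ∑ i, ∑ j, (RCLike.re (T i j) * RCLike.re (M i j) + RCLike.im (T i j) * RCLike.im (M i j))

theorem frobSq_nonneg {m n : ℕ} (M : Matrix (Fin m) (Fin n) 𝕜) : 0 ≤ frobSq M :=
  Finset.sum_nonneg fun _ _ => Finset.sum_nonneg fun _ _ => sq_nonneg _

theorem frobInner_self {m n : ℕ} (M : Matrix (Fin m) (Fin n) 𝕜) :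
    frobInner M M = frobSq M := by
  simp only [frobInner, frobSq, RCLike.norm_sq_eq_def]

theorem frobInner_eq_trace {m n : ℕ} (T M : Matrix (Fin m) (Fin n) 𝕜) :
    frobInner T M = RCLike.re (Tᴴ * M).trace := by
  simp only [frobInner, trace, diag, mul_apply, conjTranspose_apply, map_sum, RCLike.mul_re,
    RCLike.star_def, RCLike.conj_re, RCLike.conj_im]
  rw [Finset.sum_comm]
  simp

theorem frobSq_conjTranspose {m n : ℕ} (M : Matrix (Fin m) (Fin n) 𝕜) :
    frobSq Mᴴ = frobSq M := by
  simp only [frobSq, conjTranspose_apply, norm_star]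
  rw [Finset.sum_comm]

theorem frobInner_comm {m n : ℕ} (T M : Matrix (Fin m) (Fin n) 𝕜) :
    frobInner T M = frobInner M T := by
  simp only [frobInner, mul_comm]

theorem frobInner_add_right {m n : ℕ} (T M N : Matrix (Fin m) (Fin n) 𝕜) :
    frobInner T (M + N) = frobInner T M + frobInner T N := by
  simp only [frobInner, Matrix.add_apply, map_add, ← Finset.sum_add_distrib]
  exact Finset.sum_congr rfl fun _ _ => Finset.sum_congr rfl fun _ _ => by ring

theorem frobSq_add {m n : ℕ} (M N : Matrix (Fin m) (Fin n) 𝕜) :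
    frobSq (M + N) = frobSq M + 2 * frobInner M N + frobSq N := by
  rw [← frobInner_self, frobInner_add_right, frobInner_comm, frobInner_add_right,
    frobInner_comm (M + N) N, frobInner_add_right, frobInner_self, frobInner_self,
    frobInner_comm N M]
  ring

theorem frobInner_conjTranspose {m n : ℕ} (T : Matrix (Fin n) (Fin m) 𝕜)
    (M : Matrix (Fin m) (Fin n) 𝕜) : frobInner T Mᴴ = frobInner Tᴴ M := by
  simp only [frobInner, conjTranspose_apply, RCLike.star_def, RCLike.conj_re, RCLike.conj_im]
  rw [Finset.sum_comm]
  simp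

theorem frobInner_mul_left {m n p : ℕ} (T : Matrix (Fin m) (Fin n) 𝕜)
    (K : Matrix (Fin m) (Fin p) 𝕜) (M : Matrix (Fin p) (Fin n) 𝕜) :
    frobInner T (K * M) = frobInner (Kᴴ * T) M := by
  rw [frobInner_eq_trace, frobInner_eq_trace, conjTranspose_mul, conjTranspose_conjTranspose,
    Matrix.mul_assoc]

theorem frobInner_mul_right {m n p : ℕ} (T : Matrix (Fin m) (Fin n) 𝕜)
    (M : Matrix (Fin m) (Fin p) 𝕜) (K : Matrix (Fin p) (Fin n) 𝕜) :
    frobInner T (M * K) = frobInner (T * Kᴴ) M := by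
  rw [frobInner_eq_trace, frobInner_eq_trace, conjTranspose_mul, conjTranspose_conjTranspose,
    ← Matrix.mul_assoc, trace_mul_comm, Matrix.mul_assoc]

theorem continuous_frobInner {m n : ℕ} :
    Continuous fun p : Matrix (Fin m) (Fin n) 𝕜 × Matrix (Fin m) (Fin n) 𝕜 =>
      frobInner p.1 p.2 := by
  unfold frobInner
  have h1 : ∀ i j, Continuous fun p : Matrix (Fin m) (Fin n) 𝕜 × Matrix (Fin m) (Fin n) 𝕜 =>
    p.1 i j := fun i j => continuous_fst.matrix_elem i j
  have h2 : ∀ i j, Continuous fun p : Matrix (Fin m) (Fin n) 𝕜 × Matrix (Fin m) (Fin n) 𝕜 =>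
    p.2 i j := fun i j => continuous_snd.matrix_elem i j
  refine continuous_finsetSum _ fun i _ => continuous_finsetSum _ fun j _ => ?_
  exact ((RCLike.continuous_re.comp (h1 i j)).mul (RCLike.continuous_re.comp (h2 i j))).add
    ((RCLike.continuous_im.comp (h1 i j)).mul (RCLike.continuous_im.comp (h2 i j)))

theorem continuous_frobSq {m n : ℕ} :
    Continuous fun M : Matrix (Fin m) (Fin n) 𝕜 => frobSq M := by
  simp_rw [← frobInner_self]
  exact continuous_frobInner.comp (continuous_id.prodMk continuous_id)

/-- The real Frobenius inner product as a bilinear map. -/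
noncomputable def frobInnerₗ (𝕜 : Type*) [RCLike 𝕜] (m n : ℕ) :
    (Fin m → Fin n → 𝕜) →ₗ[ℝ] (Fin m → Fin n → 𝕜) →ₗ[ℝ] ℝ :=
  LinearMap.mk₂ ℝ (fun T M => frobInner (Matrix.of T) (Matrix.of M))
    (fun T T' M => by
      rw [frobInner_comm, ← of_add_of, frobInner_add_right, frobInner_comm, frobInner_comm _ (of T')])
    (fun c T M => by
      simp only [frobInner, of_apply, Pi.smul_apply, RCLike.smul_re, RCLike.smul_im, smul_eq_mul,
        Finset.mul_sum, mul_add, mul_assoc])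
    (fun T M M' => by rw [← of_add_of, frobInner_add_right])
    (fun c T M => by
      simp only [frobInner, of_apply, Pi.smul_apply, RCLike.smul_re, RCLike.smul_im, smul_eq_mul,
        Finset.mul_sum, mul_add, mul_left_comm])

theorem frobSq_eq_zero {m n : ℕ} {M : Matrix (Fin m) (Fin n) 𝕜} (h : frobSq M = 0) : M = 0 := by
  ext i j
  have h1 := (Finset.sum_eq_zero_iff_of_nonneg
    (fun i _ => Finset.sum_nonneg fun j _ => sq_nonneg ‖M i j‖)).1 h i (Finset.mem_univ _)
  have h2 := (Finset.sum_eq_zero_iff_of_nonneg (fun j _ => sq_nonneg ‖M i j‖)).1 h1 j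
    (Finset.mem_univ _)
  simpa using h2

/-- The pairing is nondegenerate, so its characters separate finite measures. The statement is about
the plain function type for the sake of its instances; the version for `Matrix` is the same by
unfolding. -/
theorem ext_of_frobInnerₗ_char {m n : ℕ} {μ ν : Measure (Fin m → Fin n → 𝕜)}
    [IsFiniteMeasure μ] [IsFiniteMeasure ν]
    (h : ∀ T, ∫ M, Complex.exp (frobInnerₗ 𝕜 m n T M * Complex.I) ∂μ =
      ∫ M, Complex.exp (frobInnerₗ 𝕜 m n T M * Complex.I) ∂ν) : μ = ν := by
  have hcomm : ∀ T M, frobInnerₗ 𝕜 m n T M = frobInnerₗ 𝕜 m n M T :=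
    fun T M => frobInner_comm (Matrix.of T) (Matrix.of M)
  refine ext_of_integral_char_eq (L := frobInnerₗ 𝕜 m n) Real.continuous_probChar
    Real.probChar_ne_one (fun v hv hv0 => hv ?_) continuous_frobInner fun w => ?_
  · have h1 : frobInnerₗ 𝕜 m n v v = 0 := by rw [hv0]; rfl
    have h2 : frobInner (Matrix.of v) (Matrix.of v) = 0 := h1
    rw [frobInner_self] at h2
    exact frobSq_eq_zero h2
  · have h' := h w
    simp_rw [hcomm w] at h'
    exact h'

/-- Finite measures on matrices with the same characteristic function are equal. -/
theorem ext_of_frobInner_char {m n : ℕ} {μ ν : Measure (Matrix (Fin m) (Fin n) 𝕜)}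
    [hμ : IsFiniteMeasure μ] [hν : IsFiniteMeasure ν]
    (h : ∀ T, ∫ M, Complex.exp (frobInner T M * Complex.I) ∂μ =
      ∫ M, Complex.exp (frobInner T M * Complex.I) ∂ν) : μ = ν :=
  @ext_of_frobInnerₗ_char 𝕜 _ m n μ ν hμ hν h

/-! ### The standard normal law on matrices -/

/-- The matrix with the given real and imaginary parts. -/
noncomputable def ofReIm {m n : ℕ} (p : (Fin m × Fin n → ℝ) × (Fin m × Fin n → ℝ)) :
    Matrix (Fin m) (Fin n) 𝕜 :=
  Matrix.of fun i j => (p.1 (i, j) : 𝕜) + (p.2 (i, j) : 𝕜) * RCLike.I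

theorem measurable_ofReIm {m n : ℕ} :
    Measurable (ofReIm : _ → Matrix (Fin m) (Fin n) 𝕜) := by
  refine measurable_pi_iff.2 fun i => measurable_pi_iff.2 fun j => ?_
  have h1 : Measurable fun p : (Fin m × Fin n → ℝ) × (Fin m × Fin n → ℝ) => (p.1 (i, j) : 𝕜) :=
    RCLike.continuous_ofReal.measurable.comp (by fun_prop)
  have h2 : Measurable fun p : (Fin m × Fin n → ℝ) × (Fin m × Fin n → ℝ) => (p.2 (i, j) : 𝕜) :=
    RCLike.continuous_ofReal.measurable.comp (by fun_prop)
  exact h1.add (h2.mul_const _)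

/-- The product of standard normal laws on a finite index type. -/
noncomputable abbrev piGauss (ι : Type*) [Fintype ι] : Measure (ι → ℝ) :=
  Measure.pi fun _ => gaussianReal 0 1

/-- The law of a standard normal matrix. -/
noncomputable def stdNormalLaw (𝕜 : Type*) [RCLike 𝕜] (m n : ℕ) :
    Measure (Matrix (Fin m) (Fin n) 𝕜) :=
  ((piGauss (Fin m × Fin n)).prod (piGauss (Fin m × Fin n))).map ofReIm

instance isProbabilityMeasure_stdNormalLaw (m n : ℕ) :
    IsProbabilityMeasure (stdNormalLaw 𝕜 m n) :=
  Measure.isProbabilityMeasure_map measurable_ofReIm.aemeasurable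

theorem IsRealStdNormal.aemeasurable {S : Type*} [MeasurableSpace S] {P : Measure S} {m n : ℕ}
    {G : S → Matrix (Fin m) (Fin n) ℝ} (h : IsRealStdNormal G P) : AEMeasurable G P :=
  aemeasurable_pi_iff.2 fun i => aemeasurable_pi_iff.2 fun j => (h.law i j).aemeasurable

theorem IsRealStdNormal.map_eq {S : Type*} [MeasurableSpace S] {P : Measure S}
    [IsProbabilityMeasure P] {m n : ℕ}
    {G : S → Matrix (Fin m) (Fin n) ℝ} (h : IsRealStdNormal G P) :
    P.map (fun s (p : Fin m × Fin n) => G s p.1 p.2) = piGauss (Fin m × Fin n) := by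
  refine ((iIndepFun_iff_map_fun_eq_pi_map
    (f := fun (p : Fin m × Fin n) (s : S) => G s p.1 p.2)
    fun p => (h.law p.1 p.2).aemeasurable).1 h.indep).trans ?_
  congr 1
  funext p
  exact (h.law p.1 p.2).map_eq

/-- Independence makes the joint law of the entries a product, so the hypotheses amount to one
concrete law on matrix space, and the rest of the proof can forget `S`. -/
theorem IsStdNormal.aemeasurable_map_eq {S : Type*} [MeasurableSpace S] {P : Measure S}
    [IsProbabilityMeasure P] {m n : ℕ} {G : S → Matrix (Fin m) (Fin n) 𝕜}
    (h : IsStdNormal G P) : AEMeasurable G P ∧ P.map G = stdNormalLaw 𝕜 m n := by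
  have hre : AEMeasurable (fun s (p : Fin m × Fin n) => RCLike.re (G s p.1 p.2)) P :=
    aemeasurable_pi_iff.2 fun p => (h.re.law p.1 p.2).aemeasurable
  have e1 : P.map (fun s (p : Fin m × Fin n) => RCLike.re (G s p.1 p.2)) =
    piGauss (Fin m × Fin n) := h.re.map_eq
  -- If `I = 0`, then `ofReIm` ignores its second argument, so the product law has a spare factor
  -- that integrates out.
  by_cases hI : (RCLike.I : 𝕜) = 0
  · have hG : G = (fun x : Fin m × Fin n → ℝ => (ofReIm (x, 0) : Matrix (Fin m) (Fin n) 𝕜)) ∘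
        fun s (p : Fin m × Fin n) => RCLike.re (G s p.1 p.2) := by
      funext s; ext i j
      have := RCLike.re_add_im (G s i j)
      rw [hI, mul_zero, add_zero] at this
      simp [ofReIm, this]
    have hm : Measurable fun x : Fin m × Fin n → ℝ =>
      (ofReIm (x, 0) : Matrix (Fin m) (Fin n) 𝕜) := measurable_ofReIm.comp (by fun_prop)
    constructor
    · rw [hG]; exact hm.comp_aemeasurable hre
    · rw [hG, ← AEMeasurable.map_map_of_aemeasurable hm.aemeasurable hre, e1, stdNormalLaw]
      have : (ofReIm : _ → Matrix (Fin m) (Fin n) 𝕜) =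
          (fun x : Fin m × Fin n → ℝ => (ofReIm (x, 0) : Matrix (Fin m) (Fin n) 𝕜)) ∘ Prod.fst := by
        funext p; ext i j
        simp [ofReIm, hI]
      rw [this, ← Measure.map_map hm measurable_fst, Measure.map_fst_prod]
      simp
  · have him : AEMeasurable (fun s (p : Fin m × Fin n) => RCLike.im (G s p.1 p.2)) P :=
      aemeasurable_pi_iff.2 fun p => ((h.im hI).law p.1 p.2).aemeasurable
    have e2 : P.map (fun s (p : Fin m × Fin n) => RCLike.im (G s p.1 p.2)) =
      piGauss (Fin m × Fin n) := (h.im hI).map_eq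
    have hind : IndepFun (fun s (p : Fin m × Fin n) => RCLike.re (G s p.1 p.2))
        (fun s (p : Fin m × Fin n) => RCLike.im (G s p.1 p.2)) P := by
      have hu : Measurable fun (M : Matrix (Fin m) (Fin n) ℝ) (p : Fin m × Fin n) => M p.1 p.2 :=
        measurable_pi_iff.2 fun p => (measurable_pi_apply p.2).comp (measurable_pi_apply p.1)
      exact (h.indep hI).comp hu hu
    have e3 := (indepFun_iff_map_prod_eq_prod_map_map hre him).1 hind
    have hG : G = ofReIm ∘ fun s => (fun (p : Fin m × Fin n) => RCLike.re (G s p.1 p.2),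
        fun (p : Fin m × Fin n) => RCLike.im (G s p.1 p.2)) := by
      funext s; ext i j
      simp [ofReIm, RCLike.re_add_im]
    constructor
    · rw [hG]; exact measurable_ofReIm.comp_aemeasurable (hre.prodMk him)
    · rw [stdNormalLaw, ← e1]
      -- Both factors are the same measure and were both rewritten; the second is restored so that
      -- it can become the law of the imaginary part.
      nth_rewrite 2 [e1]
      rw [← e2, ← e3, AEMeasurable.map_map_of_aemeasurable measurable_ofReIm.aemeasurable
        (hre.prodMk him), ← hG]

/-! ### Characteristic functions and isometric images. -/

theorem frobInner_ofReIm {m n : ℕ} (T : Matrix (Fin m) (Fin n) 𝕜)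
    (p : (Fin m × Fin n → ℝ) × (Fin m × Fin n → ℝ)) :
    frobInner T (ofReIm p) = ∑ q : Fin m × Fin n, p.1 q * RCLike.re (T q.1 q.2) +
      ∑ q : Fin m × Fin n, p.2 q * RCLike.im (T q.1 q.2) := by
  rw [← Finset.sum_add_distrib, Fintype.sum_prod_type]
  refine Finset.sum_congr rfl fun i _ => Finset.sum_congr rfl fun j _ => ?_
  -- `im z * im I = im z` covers both fields: either `im I = 1` or every imaginary part vanishes.
  have := RCLike.mul_im_I_ax (T i j)
  simp only [ofReIm, of_apply, map_add, RCLike.ofReal_re, RCLike.ofReal_im, RCLike.mul_re,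
    RCLike.mul_im, RCLike.I_re]
  linear_combination p.2 (i, j) * this

theorem integral_cexp_piGauss {ι : Type*} [Fintype ι] (a : ι → ℝ) :
    ∫ x, Complex.exp ((∑ q, x q * a q : ℝ) * Complex.I) ∂piGauss ι =
      Complex.exp (-(∑ q, a q ^ 2 : ℝ) / 2) := by
  have h : ∀ x : ι → ℝ, Complex.exp ((∑ q, x q * a q : ℝ) * Complex.I) =
      ∏ q, Complex.exp ((a q : ℂ) * x q * Complex.I) := by
    intro x
    rw [← Complex.exp_sum, ← Finset.sum_mul]
    push_cast
    simp only [mul_comm]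
  simp_rw [h]
  rw [integral_fintype_prod_eq_prod (fun q (y : ℝ) => Complex.exp ((a q : ℂ) * y * Complex.I))]
  simp_rw [← charFun_apply_real, charFun_gaussianReal]
  rw [← Complex.exp_sum]
  congr 1
  push_cast
  simp [neg_div, Finset.sum_div]

/-- The characteristic function of a standard normal matrix. -/
theorem integral_cexp_stdNormalLaw {m n : ℕ} (T : Matrix (Fin m) (Fin n) 𝕜) :
    ∫ M, Complex.exp (frobInner T M * Complex.I) ∂stdNormalLaw 𝕜 m n =
      Complex.exp (-(frobSq T) / 2) := by
  have hc : Continuous fun M : Matrix (Fin m) (Fin n) 𝕜 => frobInner T M :=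
    continuous_frobInner.comp (continuous_const.prodMk continuous_id)
  rw [stdNormalLaw, integral_map measurable_ofReIm.aemeasurable
    (by fun_prop : Continuous fun M : Matrix (Fin m) (Fin n) 𝕜 =>
      Complex.exp (frobInner T M * Complex.I)).aestronglyMeasurable]
  simp_rw [frobInner_ofReIm, Complex.ofReal_add, add_mul, Complex.exp_add]
  refine (integral_prod_mul (fun x : Fin m × Fin n → ℝ => Complex.exp
      (((∑ q : Fin m × Fin n, x q * RCLike.re (T q.1 q.2) : ℝ) : ℂ) * Complex.I))
    (fun y : Fin m × Fin n → ℝ => Complex.exp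
      (((∑ q : Fin m × Fin n, y q * RCLike.im (T q.1 q.2) : ℝ) : ℂ) * Complex.I))).trans ?_
  rw [integral_cexp_piGauss fun q : Fin m × Fin n => RCLike.re (T q.1 q.2),
    integral_cexp_piGauss fun q : Fin m × Fin n => RCLike.im (T q.1 q.2), ← Complex.exp_add]
  congr 1
  rw [← frobInner_self, frobInner, ← Fintype.sum_prod_type', Finset.sum_add_distrib]
  push_cast
  simp only [← sq]
  ring

/-- The sum of images of two independent standard normal matrices under two linear maps with
adjoints `g₁`, `g₂` is standard normal when `(g₁, g₂)` is isometric. -/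
theorem map_add_stdNormalLaw {m₁ n₁ m₂ n₂ m n : ℕ}
    {f₁ : Matrix (Fin m₁) (Fin n₁) 𝕜 → Matrix (Fin m) (Fin n) 𝕜}
    {f₂ : Matrix (Fin m₂) (Fin n₂) 𝕜 → Matrix (Fin m) (Fin n) 𝕜}
    (g₁ : Matrix (Fin m) (Fin n) 𝕜 → Matrix (Fin m₁) (Fin n₁) 𝕜)
    (g₂ : Matrix (Fin m) (Fin n) 𝕜 → Matrix (Fin m₂) (Fin n₂) 𝕜)
    (hf₁ : Measurable f₁) (hf₂ : Measurable f₂)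
    (h₁ : ∀ T M, frobInner T (f₁ M) = frobInner (g₁ T) M)
    (h₂ : ∀ T M, frobInner T (f₂ M) = frobInner (g₂ T) M)
    (h : ∀ T, frobSq (g₁ T) + frobSq (g₂ T) = frobSq T) :
    ((stdNormalLaw 𝕜 m₁ n₁).prod (stdNormalLaw 𝕜 m₂ n₂)).map (fun p => f₁ p.1 + f₂ p.2) =
      stdNormalLaw 𝕜 m n := by
  have hadd : Measurable fun p : Matrix (Fin m) (Fin n) 𝕜 × Matrix (Fin m) (Fin n) 𝕜 =>
    p.1 + p.2 := continuous_add.measurable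
  have hf : Measurable fun p : Matrix (Fin m₁) (Fin n₁) 𝕜 × Matrix (Fin m₂) (Fin n₂) 𝕜 =>
    f₁ p.1 + f₂ p.2 := hadd.comp
      ((hf₁.comp measurable_fst).prodMk (hf₂.comp measurable_snd))
  have := Measure.isProbabilityMeasure_map (μ := (stdNormalLaw 𝕜 m₁ n₁).prod
    (stdNormalLaw 𝕜 m₂ n₂)) hf.aemeasurable
  refine ext_of_frobInner_char fun T => ?_
  have hc : Continuous fun M : Matrix (Fin m) (Fin n) 𝕜 => frobInner T M :=
    continuous_frobInner.comp (continuous_const.prodMk continuous_id)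
  rw [integral_map hf.aemeasurable
    (by fun_prop : Continuous fun M : Matrix (Fin m) (Fin n) 𝕜 =>
      Complex.exp (frobInner T M * Complex.I)).aestronglyMeasurable]
  simp_rw [frobInner_add_right, h₁, h₂, Complex.ofReal_add, add_mul, Complex.exp_add]
  rw [integral_prod_mul (fun x => Complex.exp ((frobInner (g₁ T) x : ℂ) * Complex.I))
    (fun y => Complex.exp ((frobInner (g₂ T) y : ℂ) * Complex.I)),
    integral_cexp_stdNormalLaw, integral_cexp_stdNormalLaw, integral_cexp_stdNormalLaw,
    ← Complex.exp_add, ← h T]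
  congr 1
  push_cast
  ring

/-- The characteristic function at `T` depends only on `frobSq T`, so a map with isometric adjoint
`g` preserves standard normality. -/
theorem map_stdNormalLaw {m₁ n₁ m n : ℕ}
    {f : Matrix (Fin m₁) (Fin n₁) 𝕜 → Matrix (Fin m) (Fin n) 𝕜}
    (g : Matrix (Fin m) (Fin n) 𝕜 → Matrix (Fin m₁) (Fin n₁) 𝕜)
    (hf : Measurable f) (hfg : ∀ T M, frobInner T (f M) = frobInner (g T) M)
    (h : ∀ T, frobSq (g T) = frobSq T) :
    (stdNormalLaw 𝕜 m₁ n₁).map f = stdNormalLaw 𝕜 m n := by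
  have := Measure.isProbabilityMeasure_map (μ := stdNormalLaw 𝕜 m₁ n₁) hf.aemeasurable
  refine ext_of_frobInner_char fun T => ?_
  have hc : Continuous fun M : Matrix (Fin m) (Fin n) 𝕜 => frobInner T M :=
    continuous_frobInner.comp (continuous_const.prodMk continuous_id)
  rw [integral_map hf.aemeasurable
    (by fun_prop : Continuous fun M : Matrix (Fin m) (Fin n) 𝕜 =>
      Complex.exp (frobInner T M * Complex.I)).aestronglyMeasurable]
  simp_rw [hfg]
  rw [integral_cexp_stdNormalLaw, integral_cexp_stdNormalLaw, h]

/-! ### Moments of standard normal matrices -/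

/-- The real dimension of the field. -/
noncomputable def realDim (𝕜 : Type*) [RCLike 𝕜] : ℝ := 1 + RCLike.im (RCLike.I : 𝕜) ^ 2

theorem im_I_sq (𝕜 : Type*) [RCLike 𝕜] : RCLike.im (RCLike.I : 𝕜) ^ 2 = 1 - alpha 𝕜 := by
  unfold alpha
  by_cases hI : (RCLike.I : 𝕜) = 0
  · simp [hI]
  · have h := RCLike.mul_im_I_ax (RCLike.I : 𝕜)
    have h0 : RCLike.im (RCLike.I : 𝕜) ≠ 0 := fun h0 => hI <| by
      have := RCLike.re_add_im (RCLike.I : 𝕜)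
      rwa [RCLike.I_re, h0, RCLike.ofReal_zero, zero_mul, zero_add, eq_comm] at this
    simp [hI, mul_left_cancel₀ h0 (h.trans (mul_one _).symm)]

theorem realDim_eq (𝕜 : Type*) [RCLike 𝕜] : realDim 𝕜 = 2 - alpha 𝕜 := by
  rw [realDim, im_I_sq]; ring

theorem alpha_eq_zero_or_one (𝕜 : Type*) [RCLike 𝕜] : alpha 𝕜 = 0 ∨ alpha 𝕜 = 1 := by
  unfold alpha
  split_ifs <;> simp

/-! ### Laplace transforms and the mean of an inverse chi-squared variable. -/

theorem integral_exp_neg_mul_sq_gaussianReal {s : ℝ} (hs : 0 ≤ s) :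
    ∫ x, Real.exp (-(s * x ^ 2)) ∂gaussianReal 0 1 = (1 + 2 * s) ^ (-(1 / 2) : ℝ) := by
  rw [integral_gaussianReal_eq_integral_smul one_ne_zero]
  have h : ∀ x : ℝ, gaussianPDFReal 0 1 x • Real.exp (-(s * x ^ 2)) =
      (√(2 * Real.pi))⁻¹ * Real.exp (-(s + 1 / 2) * x ^ 2) := by
    intro x
    simp only [gaussianPDFReal, NNReal.coe_one, mul_one, sub_zero, smul_eq_mul]
    rw [mul_assoc, ← Real.exp_add]
    congr 2
    ring
  simp_rw [h]
  rw [integral_const_mul, integral_gaussian, ← Real.sqrt_inv, ← Real.sqrt_mul (by positivity),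
    Real.rpow_neg (by positivity), ← Real.sqrt_eq_rpow, ← Real.sqrt_inv]
  congr 1
  have := Real.pi_pos
  field_simp
  ring

theorem integral_exp_neg_mul_sum_sq_piGauss {ι : Type*} [Fintype ι] {s : ℝ} (hs : 0 ≤ s) :
    ∫ x, Real.exp (-(s * ∑ q, x q ^ 2)) ∂piGauss ι =
      (1 + 2 * s) ^ (-(Fintype.card ι / 2) : ℝ) := by
  have h : ∀ x : ι → ℝ, Real.exp (-(s * ∑ q, x q ^ 2)) = ∏ q, Real.exp (-(s * x q ^ 2)) := by
    intro x
    rw [← Real.exp_sum, Finset.sum_neg_distrib, Finset.mul_sum]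
  simp_rw [h]
  rw [integral_fintype_prod_eq_prod (fun _ (y : ℝ) => Real.exp (-(s * y ^ 2)))]
  simp_rw [integral_exp_neg_mul_sq_gaussianReal hs]
  rw [Finset.prod_const, Finset.card_univ, ← Real.rpow_natCast, ← Real.rpow_mul (by positivity)]
  congr 1
  ring

theorem frobSq_ofReIm {m n : ℕ} (p : (Fin m × Fin n → ℝ) × (Fin m × Fin n → ℝ)) :
    frobSq (ofReIm p : Matrix (Fin m) (Fin n) 𝕜) = ∑ q, p.1 q ^ 2 +
      RCLike.im (RCLike.I : 𝕜) ^ 2 * ∑ q, p.2 q ^ 2 := by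
  rw [Finset.mul_sum, ← Finset.sum_add_distrib, Fintype.sum_prod_type]
  refine Finset.sum_congr rfl fun i _ => Finset.sum_congr rfl fun j _ => ?_
  rw [RCLike.norm_sq_eq_def]
  simp only [ofReIm, of_apply, map_add, RCLike.ofReal_re, RCLike.ofReal_im, RCLike.mul_re,
    RCLike.mul_im, RCLike.I_re]
  ring

/-- The Laplace transform of the squared Frobenius norm of a standard normal matrix. -/
theorem integral_exp_neg_frobSq {m n : ℕ} {t : ℝ} (ht : 0 ≤ t) :
    ∫ M, Real.exp (-(t * frobSq M)) ∂stdNormalLaw 𝕜 m n =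
      (1 + 2 * t) ^ (-(realDim 𝕜 * (m * n) / 2)) := by
  have hc : Continuous fun M : Matrix (Fin m) (Fin n) 𝕜 => Real.exp (-(t * frobSq M)) := by
    have := continuous_frobSq (𝕜 := 𝕜) (m := m) (n := n)
    fun_prop
  rw [stdNormalLaw, integral_map measurable_ofReIm.aemeasurable hc.aestronglyMeasurable]
  simp_rw [frobSq_ofReIm, mul_add, neg_add, Real.exp_add]
  refine (integral_prod_mul (fun x : Fin m × Fin n → ℝ => Real.exp (-(t * ∑ q, x q ^ 2)))
    (fun y : Fin m × Fin n → ℝ => Real.exp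
      (-(t * (RCLike.im (RCLike.I : 𝕜) ^ 2 * ∑ q, y q ^ 2))))).trans ?_
  simp_rw [← mul_assoc]
  rw [integral_exp_neg_mul_sum_sq_piGauss ht, integral_exp_neg_mul_sum_sq_piGauss (by positivity),
    realDim, im_I_sq]
  simp only [Fintype.card_prod, Fintype.card_fin, Nat.cast_mul]
  rcases alpha_eq_zero_or_one 𝕜 with h | h <;> rw [h]
  · rw [Nat.cast_zero, sub_zero, mul_one, ← Real.rpow_add (by positivity)]
    congr 1
    ring
  · simp

/-- Writes `1 / q` as an integral of exponentials, so that its mean follows from the Laplace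
transform by Tonelli. At `q = 0` both sides are infinite. -/
theorem lintegral_Ioi_exp_neg_mul {q : ℝ} (hq : 0 ≤ q) :
    (ENNReal.ofReal q)⁻¹ ≤ ∫⁻ t in Set.Ioi (0 : ℝ), ENNReal.ofReal (Real.exp (-(t * q))) := by
  rcases hq.eq_or_lt with rfl | hq
  · simp
  · have h : ∀ t : ℝ, -(t * q) = -q * t := fun t => by ring
    simp_rw [h]
    rw [← ofReal_integral_eq_lintegral_ofReal
      (integrableOn_exp_mul_Ioi (neg_lt_zero.2 hq) 0) (ae_of_all _ fun _ => (Real.exp_pos _).le),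
      integral_exp_mul_Ioi (neg_lt_zero.2 hq), ← ENNReal.ofReal_inv_of_pos hq]
    simp

/-- An antiderivative is `-(1 + 2 t) ^ (1 - D / 2) / (D - 2)`, which tends to zero at infinity
because `D > 2`. -/
theorem lintegral_Ioi_rpow_one_add {D : ℝ} (hD : 2 < D) :
    ∫⁻ t in Set.Ioi (0 : ℝ), ENNReal.ofReal ((1 + 2 * t) ^ (-(D / 2))) =
      ENNReal.ofReal (1 / (D - 2)) := by
  have hD' : D - 2 ≠ 0 := by linarith
  have hd : ∀ x ∈ Set.Ioi (0 : ℝ), HasDerivAt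
      (fun t : ℝ => -(1 / (D - 2)) * (1 + 2 * t) ^ (-(D / 2 - 1))) ((1 + 2 * x) ^ (-(D / 2))) x := by
    intro x hx
    have hx : 0 < x := hx
    have h1 : HasDerivAt (fun t : ℝ => 1 + 2 * t) (2 * 1) x :=
      ((hasDerivAt_id x).const_mul 2).const_add 1
    have h2 := (h1.rpow_const (p := -(D / 2 - 1)) (Or.inl (by positivity))).const_mul
      (-(1 / (D - 2)))
    refine h2.congr_deriv ?_
    rw [show -(D / 2 - 1) - 1 = -(D / 2) by ring]
    field_simp
  have hcont : ContinuousWithinAt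
      (fun t : ℝ => -(1 / (D - 2)) * (1 + 2 * t) ^ (-(D / 2 - 1))) (Set.Ici 0) 0 := by
    refine ContinuousAt.continuousWithinAt (continuousAt_const.mul ?_)
    exact ContinuousAt.rpow_const (by fun_prop) (Or.inl (by norm_num))
  have hpos : ∀ x ∈ Set.Ioi (0 : ℝ), 0 ≤ (1 + 2 * x) ^ (-(D / 2)) := by
    intro x hx
    have hx : 0 < x := hx
    positivity
  have hlim : Filter.Tendsto
      (fun t : ℝ => -(1 / (D - 2)) * (1 + 2 * t) ^ (-(D / 2 - 1))) Filter.atTop (nhds 0) := by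
    have h1 : Filter.Tendsto (fun t : ℝ => 1 + 2 * t) Filter.atTop Filter.atTop :=
      Filter.tendsto_atTop_add_const_left _ _
        (Filter.tendsto_id.const_mul_atTop (by norm_num : (0 : ℝ) < 2))
    have h2 := (tendsto_rpow_neg_atTop (y := D / 2 - 1) (by linarith)).comp h1
    simpa using h2.const_mul (-(1 / (D - 2)))
  rw [← ofReal_integral_eq_lintegral_ofReal
    (integrableOn_Ioi_deriv_of_nonneg hcont hd hpos hlim)
    ((ae_restrict_iff' measurableSet_Ioi).2 (ae_of_all _ hpos)),
    integral_Ioi_of_hasDerivAt_of_nonneg hcont hd hpos hlim]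
  simp

/-- The mean of the inverse of a chi-squared variable. -/
theorem lintegral_inv_frobSq_le {m n : ℕ} (h : 2 < realDim 𝕜 * (m * n)) :
    ∫⁻ M, (ENNReal.ofReal (frobSq M))⁻¹ ∂stdNormalLaw 𝕜 m n ≤
      ENNReal.ofReal (1 / (realDim 𝕜 * (m * n) - 2)) := by
  have hc : Continuous fun p : Matrix (Fin m) (Fin n) 𝕜 × ℝ =>
      Real.exp (-(p.2 * frobSq p.1)) := by
    have := (continuous_frobSq (𝕜 := 𝕜) (m := m) (n := n)).comp
      (continuous_fst (X := Matrix (Fin m) (Fin n) 𝕜) (Y := ℝ))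
    have h2 : Continuous fun p : Matrix (Fin m) (Fin n) 𝕜 × ℝ => frobSq p.1 := this
    fun_prop
  calc ∫⁻ M, (ENNReal.ofReal (frobSq M))⁻¹ ∂stdNormalLaw 𝕜 m n
      ≤ ∫⁻ M, (∫⁻ t in Set.Ioi (0 : ℝ), ENNReal.ofReal (Real.exp (-(t * frobSq M))))
          ∂stdNormalLaw 𝕜 m n := lintegral_mono fun M => lintegral_Ioi_exp_neg_mul (frobSq_nonneg M)
    _ = ∫⁻ t in Set.Ioi (0 : ℝ), ∫⁻ M, ENNReal.ofReal (Real.exp (-(t * frobSq M)))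
          ∂stdNormalLaw 𝕜 m n := lintegral_lintegral_swap
            (hc.measurable.ennreal_ofReal.aemeasurable)
    _ = ∫⁻ t in Set.Ioi (0 : ℝ),
          ENNReal.ofReal ((1 + 2 * t) ^ (-(realDim 𝕜 * (m * n) / 2))) := by
        refine setLIntegral_congr_fun measurableSet_Ioi fun t ht => ?_
        have ht : 0 ≤ t := le_of_lt ht
        have hct : Continuous fun M : Matrix (Fin m) (Fin n) 𝕜 => Real.exp (-(t * frobSq M)) := by
          have := continuous_frobSq (𝕜 := 𝕜) (m := m) (n := n)
          fun_prop
        change _ = ENNReal.ofReal _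
        rw [← integral_exp_neg_frobSq ht, ofReal_integral_eq_lintegral_ofReal ?_
          (ae_of_all _ fun _ => (Real.exp_pos _).le)]
        refine Integrable.of_bound hct.aestronglyMeasurable 1 (ae_of_all _ fun M => ?_)
        rw [Real.norm_eq_abs, Real.abs_exp, Real.exp_le_one_iff, neg_nonpos]
        exact mul_nonneg ht (frobSq_nonneg M)
    _ = _ := lintegral_Ioi_rpow_one_add h

/-- A real linear functional of a standard normal matrix is centered Gaussian. -/
theorem map_frobInner_stdNormalLaw {m n : ℕ} (T : Matrix (Fin m) (Fin n) 𝕜) :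
    (stdNormalLaw 𝕜 m n).map (frobInner T) = gaussianReal 0 (frobSq T).toNNReal := by
  have hc : Continuous fun M : Matrix (Fin m) (Fin n) 𝕜 => frobInner T M :=
    continuous_frobInner.comp (continuous_const.prodMk continuous_id)
  have := Measure.isProbabilityMeasure_map (μ := stdNormalLaw 𝕜 m n) hc.measurable.aemeasurable
  refine Measure.ext_of_charFun (funext fun t => ?_)
  rw [charFun_gaussianReal, charFun_apply_real, integral_map hc.measurable.aemeasurable
    (by fun_prop)]
  have h : ∀ M : Matrix (Fin m) (Fin n) 𝕜, (t : ℂ) * (frobInner T M : ℝ) =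
      (frobInner ((t : 𝕜) • T) M : ℝ) := by
    intro M
    rw [← Complex.ofReal_mul]
    congr 1
    simp only [frobInner, Matrix.smul_apply, smul_eq_mul, RCLike.re_ofReal_mul, RCLike.im_ofReal_mul,
      Finset.mul_sum, mul_add, mul_assoc]
  have h2 : frobSq ((t : 𝕜) • T) = t ^ 2 * frobSq T := by
    simp only [frobSq, Matrix.smul_apply, smul_eq_mul, norm_mul, mul_pow, RCLike.norm_ofReal, sq_abs,
      Finset.mul_sum]
  simp_rw [h]
  rw [integral_cexp_stdNormalLaw, h2]
  congr 1
  rw [Real.coe_toNNReal _ (frobSq_nonneg T)]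
  push_cast
  ring

theorem lintegral_frobInner_sq {m n : ℕ} (T : Matrix (Fin m) (Fin n) 𝕜) :
    ∫⁻ M, ENNReal.ofReal (frobInner T M ^ 2) ∂stdNormalLaw 𝕜 m n = ENNReal.ofReal (frobSq T) := by
  have hc : Continuous fun M : Matrix (Fin m) (Fin n) 𝕜 => frobInner T M :=
    continuous_frobInner.comp (continuous_const.prodMk continuous_id)
  rw [← lintegral_map (f := fun x : ℝ => ENNReal.ofReal (x ^ 2)) (by fun_prop) hc.measurable]
  change ∫⁻ x, _ ∂((stdNormalLaw 𝕜 m n).map (frobInner T)) = _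
  rw [map_frobInner_stdNormalLaw, ← ofReal_integral_eq_lintegral_ofReal
    (f := fun x : ℝ => x ^ 2) (memLp_id_gaussianReal 2).integrable_sq (ae_of_all _ fun _ => sq_nonneg _)]
  have h := variance_id_gaussianReal (μ := 0) (v := (frobSq T).toNNReal)
  rw [variance_of_integral_eq_zero (by fun_prop) (by simp)] at h
  simp only [id_eq, Real.coe_toNNReal _ (frobSq_nonneg T)] at h
  rw [h]

/-- The real part and the imaginary part `re (-I z)` are both real linear functionals of `M`, with
second moments `frobSq C` and `|I|² frobSq C`; the factor `realDim` is `1 + |I|²`. -/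
theorem lintegral_norm_sq_sum {m n : ℕ} (C : Matrix (Fin m) (Fin n) 𝕜) :
    ∫⁻ M, ENNReal.ofReal (‖∑ a, ∑ b, C a b * M a b‖ ^ 2) ∂stdNormalLaw 𝕜 m n =
      ENNReal.ofReal (realDim 𝕜 * frobSq C) := by
  let T (c : 𝕜) : Matrix (Fin m) (Fin n) 𝕜 := Matrix.of fun a b => star (c * C a b)
  have hre : ∀ c M, RCLike.re (c * ∑ a, ∑ b, C a b * M a b) = frobInner (T c) M := by
    intro c M
    simp only [frobInner, T, of_apply, Finset.mul_sum, map_sum]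
    refine Finset.sum_congr rfl fun a _ => Finset.sum_congr rfl fun b _ => ?_
    rw [← mul_assoc, RCLike.mul_re, RCLike.star_def, RCLike.conj_re, RCLike.conj_im]
    ring
  have hT : ∀ c, frobSq (T c) = ‖c‖ ^ 2 * frobSq C := by
    intro c
    simp only [frobSq, T, of_apply, norm_star, norm_mul, mul_pow, Finset.mul_sum]
  clear_value T
  have him : ∀ z : 𝕜, RCLike.im z = RCLike.re (-RCLike.I * z) := by
    intro z
    have := RCLike.mul_im_I_ax z
    simp only [neg_mul, map_neg, RCLike.mul_re, RCLike.I_re]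
    linarith
  have hI : ‖(-RCLike.I : 𝕜)‖ ^ 2 = RCLike.im (RCLike.I : 𝕜) ^ 2 := by
    rw [norm_neg, RCLike.norm_sq_eq_def, RCLike.I_re]; ring
  have hsq : ∀ M : Matrix (Fin m) (Fin n) 𝕜, ENNReal.ofReal (‖∑ a, ∑ b, C a b * M a b‖ ^ 2) =
      ENNReal.ofReal (frobInner (T 1) M ^ 2) +
        ENNReal.ofReal (frobInner (T (-RCLike.I)) M ^ 2) := by
    intro M
    rw [← hre, ← hre, ← him, one_mul, ← ENNReal.ofReal_add (sq_nonneg _) (sq_nonneg _),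
      RCLike.norm_sq_eq_def, sq, sq]
  have hm : ∀ c, Measurable fun M : Matrix (Fin m) (Fin n) 𝕜 =>
      ENNReal.ofReal (frobInner (T c) M ^ 2) := by
    intro c
    have hc : Continuous fun M : Matrix (Fin m) (Fin n) 𝕜 => frobInner (T c) M :=
      continuous_frobInner.comp (continuous_const.prodMk continuous_id)
    exact (hc.pow 2).measurable.ennreal_ofReal
  simp_rw [hsq]
  rw [lintegral_add_left (hm _), lintegral_frobInner_sq, lintegral_frobInner_sq, hT, hT, hI,
    ← ENNReal.ofReal_add (mul_nonneg (sq_nonneg _) (frobSq_nonneg _))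
      (mul_nonneg (sq_nonneg _) (frobSq_nonneg _)), realDim, norm_one, one_pow, add_mul]

theorem realDim_nonneg (𝕜 : Type*) [RCLike 𝕜] : 0 ≤ realDim 𝕜 := by
  unfold realDim; positivity

/-- The second moment of `L Ψ B` for a standard normal matrix `Ψ`. -/
theorem lintegral_frobSq_mul_mul {m n p q : ℕ} (L : Matrix (Fin p) (Fin m) 𝕜)
    (B : Matrix (Fin n) (Fin q) 𝕜) :
    ∫⁻ M, ENNReal.ofReal (frobSq (L * M * B)) ∂stdNormalLaw 𝕜 m n =
      ENNReal.ofReal (realDim 𝕜 * (frobSq L * frobSq B)) := by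
  -- The coefficients of entry `x` of `L M B` as a linear form in `M`.
  let C (x : Fin p × Fin q) : Matrix (Fin m) (Fin n) 𝕜 :=
    Matrix.of fun a b => L x.1 a * B b x.2
  have hC : ∀ (M : Matrix (Fin m) (Fin n) 𝕜) x, (L * M * B) x.1 x.2 = ∑ a, ∑ b, C x a b * M a b := by
    intro M x
    simp only [C, of_apply, mul_apply, Finset.sum_mul]
    rw [Finset.sum_comm]
    exact Finset.sum_congr rfl fun a _ => Finset.sum_congr rfl fun b _ => by ring
  have hsq : ∀ M : Matrix (Fin m) (Fin n) 𝕜, ENNReal.ofReal (frobSq (L * M * B)) =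
      ∑ x, ENNReal.ofReal (‖∑ a, ∑ b, C x a b * M a b‖ ^ 2) := by
    intro M
    rw [← ENNReal.ofReal_sum_of_nonneg fun _ _ => sq_nonneg _, frobSq, Fintype.sum_prod_type]
    simp_rw [← hC]
  have hm : ∀ x, Measurable fun M : Matrix (Fin m) (Fin n) 𝕜 =>
      ENNReal.ofReal (‖∑ a, ∑ b, C x a b * M a b‖ ^ 2) := by
    intro x
    have hc : Continuous fun M : Matrix (Fin m) (Fin n) 𝕜 => ∑ a, ∑ b, C x a b * M a b :=
      continuous_finsetSum _ fun a _ => continuous_finsetSum _ fun b _ =>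
        continuous_const.mul (continuous_id.matrix_elem a b)
    exact (hc.norm.pow 2).measurable.ennreal_ofReal
  have hsum : ∑ x, frobSq (C x) = frobSq L * frobSq B := by
    simp only [frobSq, C, of_apply, norm_mul, mul_pow, Fintype.sum_prod_type]
    rw [Finset.sum_comm (f := fun i j => ‖B i j‖ ^ 2), Finset.sum_mul_sum]
    simp only [Finset.sum_mul_sum]
  simp_rw [hsq]
  rw [lintegral_finsetSum _ fun x _ => hm x]
  simp_rw [lintegral_norm_sq_sum]
  rw [← ENNReal.ofReal_sum_of_nonneg fun _ _ => mul_nonneg (realDim_nonneg 𝕜) (frobSq_nonneg _),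
    ← Finset.mul_sum, hsum]

/-! ### Norm identities for matrices with orthonormal columns -/

theorem frobSq_mul_add_frobSq_mul {m n p q : ℕ} {K : Matrix (Fin n) (Fin p) 𝕜}
    {L : Matrix (Fin n) (Fin q) 𝕜} (h : K * Kᴴ + L * Lᴴ = 1) (T : Matrix (Fin m) (Fin n) 𝕜) :
    frobSq (T * K) + frobSq (T * L) = frobSq T := by
  simp only [← frobInner_self, frobInner_mul_right, Matrix.mul_assoc]
  rw [frobInner_comm, frobInner_comm _ T, ← frobInner_add_right, ← Matrix.mul_add, h,
    Matrix.mul_one]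

theorem frobSq_mul_left_of_orthonormal {m n p : ℕ} {V : Matrix (Fin m) (Fin p) 𝕜}
    (hV : Vᴴ * V = 1) (M : Matrix (Fin p) (Fin n) 𝕜) : frobSq (V * M) = frobSq M := by
  rw [← frobInner_self, frobInner_mul_left, ← Matrix.mul_assoc, hV, Matrix.one_mul, frobInner_self]

theorem frobSq_mul_right_of_orthonormal {m n p : ℕ} {V : Matrix (Fin n) (Fin p) 𝕜}
    (hV : Vᴴ * V = 1) (M : Matrix (Fin m) (Fin p) 𝕜) : frobSq (M * Vᴴ) = frobSq M := by
  rw [← frobSq_conjTranspose, conjTranspose_mul, conjTranspose_conjTranspose,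
    frobSq_mul_left_of_orthonormal hV, frobSq_conjTranspose]

theorem frobSq_add_of_conjTranspose_mul_eq_zero {m n p : ℕ} {V : Matrix (Fin m) (Fin p) 𝕜}
    {N : Matrix (Fin m) (Fin n) 𝕜} (hV : Vᴴ * V = 1) (hN : Vᴴ * N = 0)
    (M : Matrix (Fin p) (Fin n) 𝕜) : frobSq (N + V * M) = frobSq N + frobSq M := by
  rw [frobSq_add, frobSq_mul_left_of_orthonormal hV, frobInner_mul_left, hN]
  simp [frobInner]

theorem conjTranspose_mul_sub_proj {m n p : ℕ} {V : Matrix (Fin m) (Fin p) 𝕜} (hV : Vᴴ * V = 1)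
    (M : Matrix (Fin m) (Fin n) 𝕜) : Vᴴ * (M - V * (Vᴴ * M)) = 0 := by
  rw [Matrix.mul_sub, ← Matrix.mul_assoc Vᴴ V, hV, Matrix.one_mul, sub_self]

/-- Pythagoras for the orthogonal projection onto the range of `V`. -/
theorem frobSq_sub_mul {m n p : ℕ} {V : Matrix (Fin m) (Fin p) 𝕜} (hV : Vᴴ * V = 1)
    (M : Matrix (Fin m) (Fin n) 𝕜) (Z : Matrix (Fin p) (Fin n) 𝕜) :
    frobSq (M - V * Z) = frobSq (M - V * (Vᴴ * M)) + frobSq (Vᴴ * M - Z) := by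
  rw [← frobSq_add_of_conjTranspose_mul_eq_zero hV (conjTranspose_mul_sub_proj hV M),
    Matrix.mul_sub]
  congr 1
  abel

theorem frobSq_conjTranspose_mul_le {m n p : ℕ} {V : Matrix (Fin m) (Fin p) 𝕜} (hV : Vᴴ * V = 1)
    (M : Matrix (Fin m) (Fin n) 𝕜) : frobSq (Vᴴ * M) ≤ frobSq M := by
  have h := frobSq_sub_mul hV M 0
  rw [Matrix.mul_zero, sub_zero, sub_zero] at h
  linarith [frobSq_nonneg (M - V * (Vᴴ * M))]

theorem frobSq_sub_proj_le {m n p : ℕ} {V : Matrix (Fin m) (Fin p) 𝕜} (hV : Vᴴ * V = 1)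
    (M : Matrix (Fin m) (Fin n) 𝕜) (Z : Matrix (Fin p) (Fin n) 𝕜) :
    frobSq (M - V * (Vᴴ * M)) ≤ frobSq (M - V * Z) := by
  rw [frobSq_sub_mul hV M Z]
  linarith [frobSq_nonneg (Vᴴ * M - Z)]

/-- The matrix whose columns are the first vectors of an orthonormal basis of a subspace. -/
theorem exists_orthonormal_columns {m d : ℕ} (K : Submodule 𝕜 (EuclideanSpace 𝕜 (Fin m)))
    (hd : d ≤ Module.finrank 𝕜 K) :
    ∃ V : Matrix (Fin m) (Fin d) 𝕜, Vᴴ * V = 1 ∧ ∀ a, WithLp.toLp 2 (fun i => V i a) ∈ K := by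
  let b := stdOrthonormalBasis 𝕜 K
  refine ⟨Matrix.of fun i a => (b (Fin.castLE hd a) : EuclideanSpace 𝕜 (Fin m)) i, ?_, fun a => ?_⟩
  · ext a c
    have h := orthonormal_iff_ite.1 b.orthonormal (Fin.castLE hd a) (Fin.castLE hd c)
    rw [Submodule.coe_inner, PiLp.inner_apply] at h
    simp only [mul_apply, conjTranspose_apply, of_apply, one_apply]
    simp only [RCLike.inner_apply, Fin.castLE_inj] at h
    rw [← h]
    exact Finset.sum_congr rfl fun i _ => mul_comm _ _
  · exact (b (Fin.castLE hd a)).2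

/-- The columns come from the orthogonal complement of the range of `N`, which has dimension `m -
rank N`. -/
theorem exists_orthonormal_conjTranspose_mul_eq_zero {m p d : ℕ} (N : Matrix (Fin m) (Fin p) 𝕜)
    (hd : d + N.rank ≤ m) :
    ∃ V : Matrix (Fin m) (Fin d) 𝕜, Vᴴ * V = 1 ∧ Vᴴ * N = 0 := by
  let R : Submodule 𝕜 (EuclideanSpace 𝕜 (Fin m)) := LinearMap.range (Matrix.toEuclideanLin N)
  have hR : Module.finrank 𝕜 R = N.rank := (Matrix.rank_eq_finrank_range_toLin N
    (PiLp.basisFun 2 𝕜 (Fin m)) (PiLp.basisFun 2 𝕜 (Fin p))).symm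
  have hsum := Submodule.finrank_add_finrank_orthogonal R
  rw [finrank_euclideanSpace_fin, hR] at hsum
  obtain ⟨V, hV, hVK⟩ := exists_orthonormal_columns Rᗮ (d := d) (by omega)
  refine ⟨V, hV, ?_⟩
  ext a j
  have h := Submodule.inner_right_of_mem_orthogonal
    (LinearMap.mem_range_self (Matrix.toEuclideanLin N) (EuclideanSpace.single j 1)) (hVK a)
  rw [← inner_conj_symm, map_eq_zero, PiLp.inner_apply] at h
  simp only [mul_apply, conjTranspose_apply, Matrix.zero_apply]
  rw [← h]
  refine Finset.sum_congr rfl fun i _ => ?_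
  simp [RCLike.inner_apply, Matrix.toLpLin_apply, mulVec_single, mul_comm]

/-- A matrix of rank at most `r` is reproduced by a projection of rank at most `r`. -/
theorem exists_orthonormal_mul_proj_eq {m n : ℕ} (B : Matrix (Fin m) (Fin n) 𝕜) :
    ∃ V : Matrix (Fin n) (Fin B.rank) 𝕜, Vᴴ * V = 1 ∧ B * (V * Vᴴ) = B := by
  let R : Submodule 𝕜 (EuclideanSpace 𝕜 (Fin n)) := LinearMap.range (Matrix.toEuclideanLin Bᴴ)
  have hR : Module.finrank 𝕜 R = B.rank := by
    open ComplexOrder in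
    rw [← rank_conjTranspose]
    exact (Matrix.rank_eq_finrank_range_toLin Bᴴ
      (PiLp.basisFun 2 𝕜 (Fin n)) (PiLp.basisFun 2 𝕜 (Fin m))).symm
  let b : OrthonormalBasis (Fin B.rank) 𝕜 R := (stdOrthonormalBasis 𝕜 R).reindex (finCongr hR)
  let V : Matrix (Fin n) (Fin B.rank) 𝕜 :=
    Matrix.of fun i a => (b a : EuclideanSpace 𝕜 (Fin n)) i
  refine ⟨V, ?_, ?_⟩
  · ext a c
    have h := orthonormal_iff_ite.1 b.orthonormal a c
    rw [Submodule.coe_inner, PiLp.inner_apply] at h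
    simp only [mul_apply, conjTranspose_apply, V, of_apply, one_apply]
    simp only [RCLike.inner_apply] at h
    rw [← h]
    exact Finset.sum_congr rfl fun i _ => mul_comm _ _
  -- `V V*` projects onto the range of `B*`, hence fixes each column of `B*`; the claim is the
  -- adjoint of this.
  · have h : V * Vᴴ * Bᴴ = Bᴴ := by
      ext i j
      let w : R := ⟨_, LinearMap.mem_range_self (Matrix.toEuclideanLin Bᴴ)
        (EuclideanSpace.single j 1)⟩
      have hw : ∀ i, (w : EuclideanSpace 𝕜 (Fin n)) i = Bᴴ i j := fun i => by
        simp [w, Matrix.toLpLin_apply, mulVec_single]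
      have hs := congrArg (fun u : R => (u : EuclideanSpace 𝕜 (Fin n)) i) (b.sum_repr' w)
      simp only [hw] at hs
      rw [← hs, Matrix.mul_assoc, mul_apply]
      simp only [Submodule.coe_sum, WithLp.ofLp_sum, Finset.sum_apply, Submodule.coe_smul,
        PiLp.smul_apply, smul_eq_mul]
      refine Finset.sum_congr rfl fun a _ => ?_
      rw [mul_comm, Submodule.coe_inner, PiLp.inner_apply, mul_apply]
      simp only [RCLike.inner_apply, hw, V, conjTranspose_apply, of_apply, RCLike.star_def]
      congr 1
      exact Finset.sum_congr rfl fun i _ => mul_comm _ _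
    have h2 := congrArg conjTranspose h
    simpa [conjTranspose_mul] using h2

/-! ### The rows of the pseudoinverse -/

/-- The inverse squared distance of the `j`-th column of `G` to the span of the others. -/
noncomputable def invDistSq {m k : ℕ} (G : Matrix (Fin m) (Fin k) 𝕜) (j : Fin k) : ENNReal :=
  ⨆ c : {c : Matrix (Fin k) (Fin 1) 𝕜 // c j 0 = 1}, (ENNReal.ofReal (frobSq (G * c.1)))⁻¹

/-- The definition as a supremum pays off here: a supremum of continuous functions, even an
uncountable one, is lower semicontinuous. -/
theorem measurable_invDistSq {m k : ℕ} (j : Fin k) :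
    Measurable fun G : Matrix (Fin m) (Fin k) 𝕜 => invDistSq G j := by
  refine LowerSemicontinuous.measurable (lowerSemicontinuous_iSup fun c => ?_)
  refine Continuous.lowerSemicontinuous ?_
  have h : Continuous fun G : Matrix (Fin m) (Fin k) 𝕜 => frobSq (G * c.1) :=
    continuous_frobSq.comp (continuous_id.matrix_mul continuous_const)
  exact (ENNReal.continuous_ofReal.comp h).inv

theorem frobSq_row {p q : ℕ} (M : Matrix (Fin p) (Fin q) 𝕜) :
    frobSq M = ∑ j, frobSq (M.submatrix (fun _ : Fin 1 => j) id) := by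
  simp [frobSq]

theorem frobSq_smul {m n : ℕ} (c : 𝕜) (M : Matrix (Fin m) (Fin n) 𝕜) :
    frobSq (c • M) = ‖c‖ ^ 2 * frobSq M := by
  simp only [frobSq, Matrix.smul_apply, smul_eq_mul, norm_mul, mul_pow, Finset.mul_sum]

/-- If row `j` of `P` has squared norm `ρ > 0`, take `c = ρ⁻¹ P P* e_j`. Then `c_j = 1`, and `G P P*
= P*` gives `‖G c‖² = ρ⁻² ρ = 1 / ρ`, so `c` contributes exactly `ρ` to the supremum. -/
theorem IsMoorePenrose.ofReal_row_le {m k : ℕ} {G : Matrix (Fin m) (Fin k) 𝕜}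
    {P : Matrix (Fin k) (Fin m) 𝕜} (h : IsMoorePenrose G P) (j : Fin k) :
    ENNReal.ofReal (frobSq (P.submatrix (fun _ : Fin 1 => j) id)) ≤ invDistSq G j := by
  set ρ := frobSq (P.submatrix (fun _ : Fin 1 => j) id) with hρ
  rcases (frobSq_nonneg (P.submatrix (fun _ : Fin 1 => j) id)).eq_or_lt with h0 | h0
  · rw [hρ, ← h0]; simp
  rw [← hρ] at h0
  have hjj : (P * Pᴴ) j j = (ρ : 𝕜) := by
    rw [mul_apply, hρ, frobSq]
    simp only [conjTranspose_apply, RCLike.star_def, RCLike.mul_conj, Finset.univ_unique,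
      Finset.sum_const, Finset.card_singleton, one_smul, submatrix_apply, id_eq]
    push_cast
    rfl
  have hGP : G * (P * Pᴴ) = Pᴴ := by
    rw [← Matrix.mul_assoc, ← h.left, ← conjTranspose_mul, ← Matrix.mul_assoc, h.mul_mul']
  let c : Matrix (Fin k) (Fin 1) 𝕜 := (ρ⁻¹ : 𝕜) • (P * Pᴴ).submatrix id (fun _ => j)
  have hc : c j 0 = 1 := by
    simp only [c, Matrix.smul_apply, submatrix_apply, id_eq, hjj, smul_eq_mul]
    exact inv_mul_cancel₀ (RCLike.ofReal_ne_zero.2 h0.ne')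
  have hGc : G * c = (ρ⁻¹ : 𝕜) • (P.submatrix (fun _ : Fin 1 => j) id)ᴴ := by
    rw [Matrix.mul_smul, conjTranspose_submatrix]
    congr 1
    conv_rhs => rw [← hGP]
    ext a b
    simp [mul_apply]
  refine le_trans ?_ (le_iSup (fun c : {c : Matrix (Fin k) (Fin 1) 𝕜 // c j 0 = 1} =>
    (ENNReal.ofReal (frobSq (G * c.1)))⁻¹) ⟨c, hc⟩)
  simp only [hGc]
  rw [frobSq_smul, frobSq_conjTranspose, ← hρ, norm_inv, RCLike.norm_ofReal, abs_of_pos h0,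
    ← ENNReal.ofReal_inv_of_pos (by positivity)]
  refine ENNReal.ofReal_le_ofReal (le_of_eq ?_)
  field_simp

/-- A kernel vector rescaled to have `j`-th entry `1` would put `0⁻¹ = ⊤` into the supremum. -/
theorem det_ne_zero_of_invDistSq_ne_top {m k : ℕ} {G : Matrix (Fin m) (Fin k) 𝕜}
    (h : ∀ j, invDistSq G j ≠ ⊤) : (Gᴴ * G).det ≠ 0 := by
  intro hdet
  obtain ⟨v, hv, hGv⟩ := Matrix.exists_mulVec_eq_zero_iff.2 hdet
  obtain ⟨j, hj⟩ : ∃ j, v j ≠ 0 := by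
    by_contra! h0
    exact hv (funext h0)
  have hGv' : G *ᵥ v = 0 := by
    open ComplexOrder in
    exact (conjTranspose_mul_self_mulVec_eq_zero G v).1 hGv
  refine h j (top_le_iff.1 ?_)
  refine le_trans ?_ (le_iSup (fun c : {c : Matrix (Fin k) (Fin 1) 𝕜 // c j 0 = 1} =>
    (ENNReal.ofReal (frobSq (G * c.1)))⁻¹)
    ⟨Matrix.of fun i _ => (v j)⁻¹ * v i, by simp [inv_mul_cancel₀ hj]⟩)
  have h0 : G * (Matrix.of fun i (_ : Fin 1) => (v j)⁻¹ * v i) = 0 := by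
    ext a b
    have := congrFun hGv' a
    simp only [mulVec, dotProduct, Pi.zero_apply] at this
    simp only [mul_apply, of_apply, Matrix.zero_apply]
    rw [← mul_zero (v j)⁻¹, ← this, Finset.mul_sum]
    exact Finset.sum_congr rfl fun i _ => by ring
  simp [h0, frobSq]

/-- The explicit formula for the pseudoinverse of a matrix with independent columns. -/
noncomputable def gramPinv {m k : ℕ} (G : Matrix (Fin m) (Fin k) 𝕜) :
    Matrix (Fin k) (Fin m) 𝕜 :=
  (Gᴴ * G)⁻¹ * Gᴴ

theorem gramPinv_mul {m k : ℕ} {G : Matrix (Fin m) (Fin k) 𝕜} (h : (Gᴴ * G).det ≠ 0) :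
    gramPinv G * G = 1 := by
  rw [gramPinv, Matrix.mul_assoc, nonsing_inv_mul _ (isUnit_iff_ne_zero.2 h)]

theorem isMoorePenrose_gramPinv {m k : ℕ} {G : Matrix (Fin m) (Fin k) 𝕜}
    (h : (Gᴴ * G).det ≠ 0) : IsMoorePenrose G (gramPinv G) where
  mul_mul := by rw [Matrix.mul_assoc, gramPinv_mul h, Matrix.mul_one]
  mul_mul' := by rw [gramPinv_mul h, Matrix.one_mul]
  left := by
    rw [gramPinv, conjTranspose_mul, conjTranspose_mul, conjTranspose_conjTranspose,
      conjTranspose_nonsing_inv, conjTranspose_mul, conjTranspose_conjTranspose, Matrix.mul_assoc]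
  right := by rw [gramPinv_mul h, conjTranspose_one]

theorem pinv_eq_gramPinv {m k : ℕ} {G : Matrix (Fin m) (Fin k) 𝕜}
    (h : (Gᴴ * G).det ≠ 0) : pinv G = gramPinv G :=
  (exists_isMoorePenrose G).choose_spec.unique (isMoorePenrose_gramPinv h)

theorem ofReal_frobSq_gramPinv_le {m k : ℕ} (G : Matrix (Fin m) (Fin k) 𝕜) :
    ENNReal.ofReal (frobSq (gramPinv G)) ≤ ∑ j, invDistSq G j := by
  by_cases h : (Gᴴ * G).det = 0
  -- The inverse of a singular matrix is `0` by convention, so the left side vanishes.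
  · rw [gramPinv, nonsing_inv_apply_not_isUnit _ (by simpa using h)]
    simp [frobSq]
  · rw [frobSq_row, ENNReal.ofReal_sum_of_nonneg fun _ _ => frobSq_nonneg _]
    exact Finset.sum_le_sum fun j _ => (isMoorePenrose_gramPinv h).ofReal_row_le j

/-- By Cramer's rule the entries are polynomials in the real and imaginary parts times an inverse
determinant. This is why the explicit formula replaces `pinv`, which is defined by choice. -/
theorem measurable_gramPinv {m k : ℕ} :
    Measurable (gramPinv : Matrix (Fin m) (Fin k) 𝕜 → Matrix (Fin k) (Fin m) 𝕜) := by
  have hct : Continuous fun G : Matrix (Fin m) (Fin k) 𝕜 => Gᴴ := continuous_id.matrix_conjTranspose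
  have hG : Continuous fun G : Matrix (Fin m) (Fin k) 𝕜 => Gᴴ * G := hct.matrix_mul continuous_id
  have hdet : Measurable fun G : Matrix (Fin m) (Fin k) 𝕜 => ((Gᴴ * G).det)⁻¹ :=
    hG.matrix_det.measurable.inv
  have hadj : Measurable fun G : Matrix (Fin m) (Fin k) 𝕜 => (Gᴴ * G).adjugate * Gᴴ :=
    (hG.matrix_adjugate.matrix_mul hct).measurable
  have heq : (gramPinv : Matrix (Fin m) (Fin k) 𝕜 → Matrix (Fin k) (Fin m) 𝕜) =
      fun G => ((Gᴴ * G).det)⁻¹ • ((Gᴴ * G).adjugate * Gᴴ) := by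
    funext G
    rw [gramPinv, inv_def, Ring.inverse_eq_inv', Matrix.smul_mul]
  rw [heq]
  refine measurable_pi_iff.2 fun i => measurable_pi_iff.2 fun j => ?_
  exact hdet.mul ((measurable_pi_apply j).comp ((measurable_pi_apply i).comp hadj))

/-! ### Gaussian expectations -/

theorem map_conjTranspose_mul_stdNormalLaw {m n p : ℕ} {V : Matrix (Fin m) (Fin p) 𝕜}
    (hV : Vᴴ * V = 1) :
    (stdNormalLaw 𝕜 m n).map (fun M => Vᴴ * M) = stdNormalLaw 𝕜 p n := by
  refine map_stdNormalLaw (fun T => V * T)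
    (continuous_const.matrix_mul continuous_id).measurable (fun T M => ?_)
    fun T => frobSq_mul_left_of_orthonormal hV T
  rw [frobInner_mul_left, conjTranspose_conjTranspose]

theorem map_mul_stdNormalLaw {m n p : ℕ} {V : Matrix (Fin n) (Fin p) 𝕜} (hV : Vᴴ * V = 1) :
    (stdNormalLaw 𝕜 m n).map (fun M => M * V) = stdNormalLaw 𝕜 m p :=
  map_stdNormalLaw (fun T => T * Vᴴ) (continuous_id.matrix_mul continuous_const).measurable
    (fun T M => frobInner_mul_right T M V) fun T => frobSq_mul_right_of_orthonormal hV T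

theorem map_conjTranspose_stdNormalLaw (m n : ℕ) :
    (stdNormalLaw 𝕜 m n).map conjTranspose = stdNormalLaw 𝕜 n m :=
  map_stdNormalLaw (fun T => Tᴴ) continuous_id.matrix_conjTranspose.measurable
    (fun T M => frobInner_conjTranspose T M) fun T => frobSq_conjTranspose T

/-- This is where `α` arises: the chi-squared variable has `β (m - k + 1)` degrees of freedom, its
inverse mean subtracts `2`, and `2 = β (1 + α)` in both fields. -/
theorem realDim_mul_sub (𝕜 : Type*) [RCLike 𝕜] (m k : ℝ) :
    realDim 𝕜 * (m - k + 1) - 2 = realDim 𝕜 * (m - k - alpha 𝕜) := by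
  rw [realDim_eq]
  rcases alpha_eq_zero_or_one 𝕜 with h | h <;> rw [h] <;> push_cast <;> ring

theorem realDim_pos (𝕜 : Type*) [RCLike 𝕜] : 0 < realDim 𝕜 := by
  unfold realDim; positivity

/-- Replacement of one part of a standard normal matrix by an independent copy. -/
theorem lintegral_stdNormalLaw_eq_add {m n p q : ℕ} {K : Matrix (Fin p) (Fin n) 𝕜}
    {L : Matrix (Fin q) (Fin n) 𝕜} (h : Kᴴ * K + Lᴴ * L = 1)
    {F : Matrix (Fin m) (Fin n) 𝕜 → ENNReal} (hF : Measurable F) :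
    ∫⁻ G, F G ∂stdNormalLaw 𝕜 m n =
      ∫⁻ G, ∫⁻ G', F (G * K + G' * L) ∂stdNormalLaw 𝕜 m q ∂stdNormalLaw 𝕜 m p := by
  have hf₁ : Continuous fun G : Matrix (Fin m) (Fin p) 𝕜 => G * K :=
    continuous_id.matrix_mul continuous_const
  have hf₂ : Continuous fun G : Matrix (Fin m) (Fin q) 𝕜 => G * L :=
    continuous_id.matrix_mul continuous_const
  have hf : Measurable fun x : Matrix (Fin m) (Fin p) 𝕜 × Matrix (Fin m) (Fin q) 𝕜 =>
      x.1 * K + x.2 * L :=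
    ((hf₁.comp continuous_fst).add (hf₂.comp continuous_snd)).measurable
  have h' : Kᴴ * Kᴴᴴ + Lᴴ * Lᴴᴴ = 1 := by
    rwa [conjTranspose_conjTranspose, conjTranspose_conjTranspose]
  rw [← map_add_stdNormalLaw (𝕜 := 𝕜) (fun T : Matrix (Fin m) (Fin n) 𝕜 => T * Kᴴ)
      (fun T => T * Lᴴ) hf₁.measurable hf₂.measurable
      (fun T M => frobInner_mul_right T M K) (fun T M => frobInner_mul_right T M L)
      (frobSq_mul_add_frobSq_mul h'), lintegral_map hF hf]
  exact lintegral_prod _ (hF.comp hf).aemeasurable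

/-- Fix all the columns but the `j`-th one; the inverse squared distance is dominated by an
inverse chi-squared variable. -/
theorem lintegral_invDistSq_column_le {m k : ℕ} (h : k + alpha 𝕜 < m) (j : Fin k)
    {N : Matrix (Fin m) (Fin k) 𝕜} (hN : N.rank + 1 ≤ k) :
    ∫⁻ g, invDistSq (N + g * (Matrix.single 0 j 1 : Matrix (Fin 1) (Fin k) 𝕜)) j
        ∂stdNormalLaw 𝕜 m 1 ≤
      ENNReal.ofReal (1 / (realDim 𝕜 * ((m : ℝ) - k - alpha 𝕜))) := by
  -- `N` has rank at most `k - 1`, leaving `m - k + 1` orthonormal directions orthogonal to it.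
  -- Compressing by `V*` removes `N` and leaves the standard normal vector `V* g`.
  obtain ⟨V, hV, hVN⟩ := exists_orthonormal_conjTranspose_mul_eq_zero (d := m - k + 1) N (by omega)
  have hpt : ∀ g : Matrix (Fin m) (Fin 1) 𝕜,
      invDistSq (N + g * (Matrix.single 0 j 1 : Matrix (Fin 1) (Fin k) 𝕜)) j ≤
        (ENNReal.ofReal (frobSq (Vᴴ * g)))⁻¹ := by
    intro g
    refine iSup_le fun c => ENNReal.inv_le_inv.2 (ENNReal.ofReal_le_ofReal ?_)
    refine le_trans (le_of_eq ?_) (frobSq_conjTranspose_mul_le hV _)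
    have hc : (Matrix.single 0 j 1 : Matrix (Fin 1) (Fin k) 𝕜) * c.1 = 1 := by
      ext a b
      rw [Subsingleton.elim a 0, Subsingleton.elim b 0]
      simp [c.2]
    rw [Matrix.add_mul, Matrix.mul_add, ← Matrix.mul_assoc, hVN, Matrix.zero_mul, zero_add,
      Matrix.mul_assoc g, hc, Matrix.mul_one]
  have hdim : ((m - k + 1 : ℕ) : ℝ) = (m : ℝ) - k + 1 := by
    rw [Nat.cast_add, Nat.cast_sub (by omega), Nat.cast_one]
  have hlt : ((k : ℝ) + alpha 𝕜) < m := by exact_mod_cast h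
  have hpos : 0 < realDim 𝕜 * ((m : ℝ) - k - alpha 𝕜) :=
    mul_pos (realDim_pos 𝕜) (by linarith)
  have hmeas : Measurable fun M : Matrix (Fin (m - k + 1)) (Fin 1) 𝕜 =>
      (ENNReal.ofReal (frobSq M))⁻¹ := continuous_frobSq.measurable.ennreal_ofReal.inv
  have hmul : Measurable fun g : Matrix (Fin m) (Fin 1) 𝕜 => Vᴴ * g :=
    (continuous_const.matrix_mul continuous_id).measurable
  calc _ ≤ ∫⁻ g, (ENNReal.ofReal (frobSq (Vᴴ * g)))⁻¹ ∂stdNormalLaw 𝕜 m 1 := lintegral_mono hpt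
    _ = ∫⁻ M, (ENNReal.ofReal (frobSq M))⁻¹ ∂stdNormalLaw 𝕜 (m - k + 1) 1 := by
        rw [← map_conjTranspose_mul_stdNormalLaw hV, lintegral_map hmeas hmul]
    _ ≤ _ := by
        refine (lintegral_inv_frobSq_le ?_).trans (le_of_eq ?_)
        · rw [hdim, Nat.cast_one, mul_one]
          linarith [realDim_mul_sub 𝕜 m k]
        · rw [hdim, Nat.cast_one, mul_one, realDim_mul_sub]

/-- `D` erases column `j` and `e` inserts an independent one. The bound for a fixed remainder is
uniform, so averaging over the remainder preserves it. -/
theorem lintegral_invDistSq_le {m k : ℕ} (h : k + alpha 𝕜 < m) (j : Fin k) :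
    ∫⁻ G, invDistSq G j ∂stdNormalLaw 𝕜 m k ≤
      ENNReal.ofReal (1 / (realDim 𝕜 * ((m : ℝ) - k - alpha 𝕜))) := by
  classical
  let D : Matrix (Fin k) (Fin k) 𝕜 := diagonal fun i => if i = j then 0 else 1
  let e : Matrix (Fin 1) (Fin k) 𝕜 := Matrix.single 0 j 1
  have hDe : Dᴴ * D + eᴴ * e = 1 := by
    simp only [D, e, diagonal_conjTranspose, diagonal_mul_diagonal,
      conjTranspose_single, star_one, single_mul_single_same, one_mul]
    ext a b
    by_cases hab : a = b
    · subst hab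
      by_cases haj : a = j
      · subst haj; simp
      · simp [haj, Ne.symm haj]
    · simp only [Matrix.add_apply, diagonal_apply_ne _ hab, one_apply_ne hab, zero_add,
        Matrix.single_apply]
      rw [if_neg]
      rintro ⟨rfl, rfl⟩
      exact hab rfl
  have hrank : ∀ G : Matrix (Fin m) (Fin k) 𝕜, (G * D).rank + 1 ≤ k := by
    intro G
    have h1 : (G * D).rank ≤ D.rank := rank_mul_le_right G D
    have h2 : D.rank < k := by
      simp only [D]
      rw [rank_diagonal]
      calc _ < Fintype.card (Fin k) := Fintype.card_subtype_lt (x := j) (by simp)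
        _ = k := Fintype.card_fin k
    omega
  rw [lintegral_stdNormalLaw_eq_add hDe (measurable_invDistSq j)]
  calc _ ≤ ∫⁻ _ : Matrix (Fin m) (Fin k) 𝕜,
        ENNReal.ofReal (1 / (realDim 𝕜 * ((m : ℝ) - k - alpha 𝕜))) ∂stdNormalLaw 𝕜 m k :=
        lintegral_mono fun G => lintegral_invDistSq_column_le h j (hrank G)
    _ = _ := by simp

/-- A standard normal matrix with more rows than columns has independent columns. -/
theorem ae_det_ne_zero {m k : ℕ} (h : k + alpha 𝕜 < m) :
    ∀ᵐ G ∂stdNormalLaw 𝕜 m k, (Gᴴ * G).det ≠ 0 := by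
  -- Finite mean forces almost sure finiteness, which excludes dependent columns.
  have hj : ∀ j, ∀ᵐ G ∂stdNormalLaw 𝕜 m k, invDistSq G j < ⊤ := fun j =>
    ae_lt_top (measurable_invDistSq j)
      ((lintegral_invDistSq_le h j).trans_lt ENNReal.ofReal_lt_top).ne
  filter_upwards [ae_all_iff.2 hj] with G hG
  exact det_ne_zero_of_invDistSq_ne_top fun j => (hG j).ne

/-- The expected squared norm of the pseudoinverse of a standard normal matrix. -/
theorem lintegral_frobSq_gramPinv_le {m k : ℕ} (h : k + alpha 𝕜 < m) :
    ∫⁻ G, ENNReal.ofReal (frobSq (gramPinv G)) ∂stdNormalLaw 𝕜 m k ≤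
      ENNReal.ofReal (k / (realDim 𝕜 * ((m : ℝ) - k - alpha 𝕜))) := by
  have hlt : ((k : ℝ) + alpha 𝕜) < m := by exact_mod_cast h
  have hpos : 0 < realDim 𝕜 * ((m : ℝ) - k - alpha 𝕜) :=
    mul_pos (realDim_pos 𝕜) (by linarith)
  calc _ ≤ ∫⁻ G, ∑ j, invDistSq G j ∂stdNormalLaw 𝕜 m k :=
        lintegral_mono ofReal_frobSq_gramPinv_le
    _ = ∑ j, ∫⁻ G, invDistSq G j ∂stdNormalLaw 𝕜 m k :=
        lintegral_finsetSum _ fun j _ => measurable_invDistSq j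
    _ ≤ ∑ _j : Fin k, ENNReal.ofReal (1 / (realDim 𝕜 * ((m : ℝ) - k - alpha 𝕜))) :=
        Finset.sum_le_sum fun j _ => lintegral_invDistSq_le h j
    _ = _ := by
        rw [← ENNReal.ofReal_sum_of_nonneg fun _ _ => by positivity]
        simp [div_eq_mul_inv]

/-! ### Mean errors of the oblique projection and of the range finder. -/

theorem measurable_matrix_mul {m n p : ℕ} : Measurable
    fun q : Matrix (Fin m) (Fin n) 𝕜 × Matrix (Fin n) (Fin p) 𝕜 => q.1 * q.2 :=
  (continuous_fst.matrix_mul continuous_snd).measurable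

theorem measurable_ofReal_frobSq_gramPinv_mul {l k q : ℕ} :
    Measurable fun p : Matrix (Fin l) (Fin k) 𝕜 × Matrix (Fin l) (Fin q) 𝕜 =>
      ENNReal.ofReal (frobSq (gramPinv p.1 * p.2)) := by
  have h : Measurable fun p : Matrix (Fin l) (Fin k) 𝕜 × Matrix (Fin l) (Fin q) 𝕜 =>
      gramPinv p.1 * p.2 :=
    measurable_matrix_mul.comp ((measurable_gramPinv.comp measurable_fst).prodMk measurable_snd)
  exact (continuous_frobSq.measurable.comp h).ennreal_ofReal

/-- The expected squared norm of `(Ψ Q)† Ψ B` when the ranges of `Q` and `B` are orthogonal. -/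
theorem lintegral_frobSq_gramPinv_mul_le {l n k q : ℕ} (h : k + alpha 𝕜 < l)
    {Q : Matrix (Fin n) (Fin k) 𝕜} (hQ : Qᴴ * Q = 1) {B : Matrix (Fin n) (Fin q) 𝕜}
    (hB : Qᴴ * B = 0) :
    ∫⁻ G, ENNReal.ofReal (frobSq (gramPinv (G * Q) * (G * B))) ∂stdNormalLaw 𝕜 l n ≤
      ENNReal.ofReal (fRatio 𝕜 k l * frobSq B) := by
  have hlt : ((k : ℝ) + alpha 𝕜) < l := by exact_mod_cast h
  have hpos : 0 < (l : ℝ) - k - alpha 𝕜 := by linarith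
  have hGF : Measurable fun G : Matrix (Fin l) (Fin n) 𝕜 =>
      ENNReal.ofReal (frobSq (gramPinv (G * Q) * (G * B))) := by
    have h1 : Measurable fun G : Matrix (Fin l) (Fin n) 𝕜 => G * Q :=
      (continuous_id.matrix_mul continuous_const).measurable
    have h2 : Measurable fun G : Matrix (Fin l) (Fin n) 𝕜 => G * B :=
      (continuous_id.matrix_mul continuous_const).measurable
    have h3 : Measurable fun G : Matrix (Fin l) (Fin n) 𝕜 => (G * Q, G * B) := h1.prodMk h2
    have h4 := (measurable_ofReal_frobSq_gramPinv_mul (𝕜 := 𝕜)).comp h3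
    exact h4
  -- Splitting `Ψ` as `G Q Q* + G' (1 - Q Q*)` with independent copies shows the independence: `Ψ Q`
  -- sees only `G`, and `Ψ B` only `G'`. No completion of `Q` to a unitary matrix is needed.
  have hPP : Q * Qᴴ * (Q * Qᴴ) = Q * Qᴴ := by
    rw [Matrix.mul_assoc, ← Matrix.mul_assoc Qᴴ, hQ, Matrix.one_mul]
  have hPh : (Q * Qᴴ)ᴴ = Q * Qᴴ := by rw [conjTranspose_mul, conjTranspose_conjTranspose]
  have hK : (Q * Qᴴ)ᴴ * (Q * Qᴴ) + (1 - Q * Qᴴ)ᴴ * (1 - Q * Qᴴ) = 1 := by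
    rw [conjTranspose_sub, hPh,
      conjTranspose_one, Matrix.mul_sub, Matrix.sub_mul, Matrix.sub_mul, hPP]
    simp
  have eQ : ∀ G G' : Matrix (Fin l) (Fin n) 𝕜,
      (G * (Q * Qᴴ) + G' * (1 - Q * Qᴴ)) * Q = G * Q := by
    intro G G'
    have h1 : Q * Qᴴ * Q = Q := by rw [Matrix.mul_assoc, hQ, Matrix.mul_one]
    rw [Matrix.add_mul, Matrix.mul_assoc, h1, Matrix.mul_assoc, Matrix.sub_mul, h1]
    simp
  have eB : ∀ G G' : Matrix (Fin l) (Fin n) 𝕜,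
      (G * (Q * Qᴴ) + G' * (1 - Q * Qᴴ)) * B = G' * B := by
    intro G G'
    have h1 : Q * Qᴴ * B = 0 := by rw [Matrix.mul_assoc, hB, Matrix.mul_zero]
    rw [Matrix.add_mul, Matrix.mul_assoc, h1, Matrix.mul_assoc, Matrix.sub_mul, h1]
    simp
  have hmg : Measurable fun G : Matrix (Fin l) (Fin k) 𝕜 =>
      ENNReal.ofReal (frobSq (gramPinv G)) :=
    (continuous_frobSq.measurable.comp measurable_gramPinv).ennreal_ofReal
  have hmQ : Measurable fun G : Matrix (Fin l) (Fin n) 𝕜 => G * Q :=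
    (continuous_id.matrix_mul continuous_const).measurable
  rw [lintegral_stdNormalLaw_eq_add hK hGF]
  simp only [eQ, eB]
  calc _ = ∫⁻ G, ENNReal.ofReal (realDim 𝕜 * frobSq B) *
          ENNReal.ofReal (frobSq (gramPinv (G * Q))) ∂stdNormalLaw 𝕜 l n := by
        refine lintegral_congr fun G => ?_
        simp only [← Matrix.mul_assoc]
        rw [lintegral_frobSq_mul_mul, ← ENNReal.ofReal_mul
          (mul_nonneg (realDim_nonneg 𝕜) (frobSq_nonneg B))]
        congr 1
        ring
    _ = ENNReal.ofReal (realDim 𝕜 * frobSq B) *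
          ∫⁻ G, ENNReal.ofReal (frobSq (gramPinv (G * Q))) ∂stdNormalLaw 𝕜 l n := by
        rw [lintegral_const_mul' _ _ ENNReal.ofReal_ne_top]
    _ = ENNReal.ofReal (realDim 𝕜 * frobSq B) *
          ∫⁻ G, ENNReal.ofReal (frobSq (gramPinv G)) ∂stdNormalLaw 𝕜 l k := by
        rw [← map_mul_stdNormalLaw hQ, lintegral_map hmg hmQ]
    _ ≤ ENNReal.ofReal (realDim 𝕜 * frobSq B) *
          ENNReal.ofReal (k / (realDim 𝕜 * ((l : ℝ) - k - alpha 𝕜))) := by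
        gcongr
        exact lintegral_frobSq_gramPinv_le h
    _ = _ := by
        rw [← ENNReal.ofReal_mul (mul_nonneg (realDim_nonneg 𝕜) (frobSq_nonneg B))]
        congr 1
        -- The field dimension cancels: it multiplies the second moment of `G'` and divides the
        -- inverse moment of `G Q`.
        have := (realDim_pos 𝕜).ne'
        rw [fRatio]
        field_simp

theorem fRatio_nonneg {s t : ℕ} (h : s + alpha 𝕜 < t) : 0 ≤ fRatio 𝕜 s t := by
  have hlt : ((s : ℝ) + alpha 𝕜) < t := by exact_mod_cast h
  exact div_nonneg (Nat.cast_nonneg _) (by linarith)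

theorem fRatio_mono {s s' t : ℕ} (h : s' + alpha 𝕜 < t) (hs : s ≤ s') :
    fRatio 𝕜 s t ≤ fRatio 𝕜 s' t := by
  have hlt : ((s' : ℝ) + alpha 𝕜) < t := by exact_mod_cast h
  have hs : (s : ℝ) ≤ s' := by exact_mod_cast hs
  exact div_le_div₀ (Nat.cast_nonneg _) hs (by linarith) (by linarith)

/-- The error of the oblique projection onto the range of `V` along the kernel of
`(Ψ V)† Ψ`. -/
theorem frobSq_sub_oblique {l n k q : ℕ} {V : Matrix (Fin n) (Fin k) 𝕜} (hV : Vᴴ * V = 1)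
    {G : Matrix (Fin l) (Fin n) 𝕜} (hG : ((G * V)ᴴ * (G * V)).det ≠ 0)
    (C : Matrix (Fin n) (Fin q) 𝕜) :
    frobSq (C - V * (gramPinv (G * V) * (G * C))) = frobSq (C - V * (Vᴴ * C)) +
      frobSq (gramPinv (G * V) * (G * (C - V * (Vᴴ * C)))) := by
  rw [frobSq_sub_mul hV]
  congr 1
  -- The oblique projection is exact on the range of `V`, so only the residual enters the second
  -- term.
  have h : gramPinv (G * V) * (G * (V * (Vᴴ * C))) = Vᴴ * C := by
    rw [← Matrix.mul_assoc G, ← Matrix.mul_assoc, gramPinv_mul hG, Matrix.one_mul]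
  rw [Matrix.mul_sub, Matrix.mul_sub, h, ← neg_sub, ← neg_one_smul 𝕜, frobSq_smul]
  simp

theorem lintegral_frobSq_sub_oblique_le {l n k q : ℕ} (h : k + alpha 𝕜 < l)
    {V : Matrix (Fin n) (Fin k) 𝕜} (hV : Vᴴ * V = 1) (C : Matrix (Fin n) (Fin q) 𝕜) :
    ∫⁻ G, ENNReal.ofReal (frobSq (C - V * (gramPinv (G * V) * (G * C)))) ∂stdNormalLaw 𝕜 l n ≤
      ENNReal.ofReal ((1 + fRatio 𝕜 k l) * frobSq (C - V * (Vᴴ * C))) := by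
  have hmV : Measurable fun G : Matrix (Fin l) (Fin n) 𝕜 => G * V :=
    (continuous_id.matrix_mul continuous_const).measurable
  have hae : ∀ᵐ G ∂stdNormalLaw 𝕜 l n, ((G * V)ᴴ * (G * V)).det ≠ 0 := by
    have := ae_det_ne_zero h
    rw [← map_mul_stdNormalLaw hV] at this
    exact ae_of_ae_map hmV.aemeasurable this
  calc _ = ∫⁻ G, (ENNReal.ofReal (frobSq (C - V * (Vᴴ * C))) +
          ENNReal.ofReal (frobSq (gramPinv (G * V) * (G * (C - V * (Vᴴ * C))))))
            ∂stdNormalLaw 𝕜 l n := by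
        refine lintegral_congr_ae ?_
        filter_upwards [hae] with G hG
        rw [frobSq_sub_oblique hV hG, ENNReal.ofReal_add (frobSq_nonneg _) (frobSq_nonneg _)]
    _ = ENNReal.ofReal (frobSq (C - V * (Vᴴ * C))) +
          ∫⁻ G, ENNReal.ofReal (frobSq (gramPinv (G * V) * (G * (C - V * (Vᴴ * C)))))
            ∂stdNormalLaw 𝕜 l n := by
        rw [lintegral_add_left measurable_const]
        simp
    _ ≤ ENNReal.ofReal (frobSq (C - V * (Vᴴ * C))) +
          ENNReal.ofReal (fRatio 𝕜 k l * frobSq (C - V * (Vᴴ * C))) := by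
        gcongr
        exact lintegral_frobSq_gramPinv_mul_le h hV (conjTranspose_mul_sub_proj hV C)
    _ = _ := by
        rw [← ENNReal.ofReal_add (frobSq_nonneg _)
          (mul_nonneg (fRatio_nonneg h) (frobSq_nonneg _)), one_add_mul]

/-- The expected error of the randomized range finder. -/
theorem lintegral_range_finder_le {m n k r : ℕ} (h : r + alpha 𝕜 < k)
    (A B : Matrix (Fin m) (Fin n) 𝕜) (hB : B.rank ≤ r) (e : Matrix (Fin n) (Fin k) 𝕜 → ℝ)
    (he : ∀ Om (Z : Matrix (Fin k) (Fin n) 𝕜), e Om ≤ frobSq (A - A * Om * Z)) :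
    ∫⁻ Om, ENNReal.ofReal (e Om) ∂stdNormalLaw 𝕜 n k ≤
      ENNReal.ofReal ((1 + fRatio 𝕜 r k) * frobSq (A - B)) := by
  obtain ⟨V, hV, hBV⟩ := exists_orthonormal_mul_proj_eq B
  have h' : B.rank + alpha 𝕜 < k := by omega
  have hle : frobSq (Aᴴ - V * (Vᴴ * Aᴴ)) ≤ frobSq (A - B) := by
    refine (frobSq_sub_proj_le hV Aᴴ (Vᴴ * Bᴴ)).trans (le_of_eq ?_)
    have : V * (Vᴴ * Bᴴ) = Bᴴ := by
      conv_rhs => rw [← hBV]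
      simp only [conjTranspose_mul, conjTranspose_conjTranspose, Matrix.mul_assoc]
    rw [this, ← conjTranspose_sub, frobSq_conjTranspose]
  have hpt : ∀ Om : Matrix (Fin n) (Fin k) 𝕜, e Om ≤
      frobSq (Aᴴ - V * (gramPinv (Omᴴ * V) * (Omᴴ * Aᴴ))) := by
    intro Om
    -- This `Z` makes the adjoint of `A - A Ω Z` the oblique projection error of `A*` under the
    -- sketch `Ω*`.
    refine (he Om ((gramPinv (Omᴴ * V))ᴴ * Vᴴ)).trans (le_of_eq ?_)
    rw [← frobSq_conjTranspose]
    simp only [conjTranspose_sub, conjTranspose_mul, conjTranspose_conjTranspose, Matrix.mul_assoc]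
  have hct : Measurable (conjTranspose : Matrix (Fin n) (Fin k) 𝕜 → Matrix (Fin k) (Fin n) 𝕜) :=
    continuous_id.matrix_conjTranspose.measurable
  have hmeas : Measurable fun G : Matrix (Fin k) (Fin n) 𝕜 =>
      ENNReal.ofReal (frobSq (Aᴴ - V * (gramPinv (G * V) * (G * Aᴴ)))) := by
    have h1 : Measurable fun G : Matrix (Fin k) (Fin n) 𝕜 => gramPinv (G * V) * (G * Aᴴ) :=
      measurable_matrix_mul.comp ((measurable_gramPinv.comp
        (continuous_id.matrix_mul continuous_const).measurable).prodMk
          (continuous_id.matrix_mul continuous_const).measurable)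
    have h2 : Continuous fun M : Matrix (Fin B.rank) (Fin m) 𝕜 => frobSq (Aᴴ - V * M) :=
      continuous_frobSq.comp (continuous_const.sub (continuous_const.matrix_mul continuous_id))
    exact (h2.measurable.comp h1).ennreal_ofReal
  calc _ ≤ ∫⁻ Om : Matrix (Fin n) (Fin k) 𝕜, ENNReal.ofReal
          (frobSq (Aᴴ - V * (gramPinv (Omᴴ * V) * (Omᴴ * Aᴴ)))) ∂stdNormalLaw 𝕜 n k :=
        lintegral_mono fun Om => ENNReal.ofReal_le_ofReal (hpt Om)
    _ = ∫⁻ G, ENNReal.ofReal (frobSq (Aᴴ - V * (gramPinv (G * V) * (G * Aᴴ))))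
          ∂stdNormalLaw 𝕜 k n := by
        rw [← map_conjTranspose_stdNormalLaw n k, lintegral_map hmeas hct]
    _ ≤ ENNReal.ofReal ((1 + fRatio 𝕜 B.rank k) * frobSq (Aᴴ - V * (Vᴴ * Aᴴ))) :=
        lintegral_frobSq_sub_oblique_le h' hV Aᴴ
    _ ≤ _ := by
        refine ENNReal.ofReal_le_ofReal (mul_le_mul ?_ hle (frobSq_nonneg _) ?_)
        · linarith [fRatio_mono h hB]
        · linarith [fRatio_nonneg h]

/-! ### The symmetric approximation -/

theorem isHermitian_symPart {n : ℕ} (M : Matrix (Fin n) (Fin n) 𝕜) : (symPart M).IsHermitian := by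
  rw [IsHermitian, symPart, conjTranspose_smul, conjTranspose_add, conjTranspose_conjTranspose,
    add_comm]
  simp

theorem symPart_add_symPart {n : ℕ} (M : Matrix (Fin n) (Fin n) 𝕜) :
    symPart M + symPart M = M + Mᴴ := by
  rw [symPart, ← add_smul, show (1 / 2 + 1 / 2 : 𝕜) = 1 by norm_num, one_smul]

/-- Taking adjoints preserves the real inner product, but flips its sign here. -/
theorem frobInner_eq_zero_of_conjTranspose {n : ℕ} {H K : Matrix (Fin n) (Fin n) 𝕜}
    (hH : Hᴴ = H) (hK : Kᴴ = -K) : frobInner H K = 0 := by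
  have h1 : frobInner H Kᴴ = frobInner H K := by rw [frobInner_conjTranspose, hH]
  have h2 : frobInner H (-K) + frobInner H K = 0 := by
    rw [← frobInner_add_right, neg_add_cancel]
    simp [frobInner]
  rw [hK] at h1
  linarith

/-- Pythagoras for the projection onto the conjugate symmetric matrices. -/
theorem frobSq_sub_eq_symPart {n : ℕ} {B : Matrix (Fin n) (Fin n) 𝕜} (hB : B.IsHermitian)
    (M : Matrix (Fin n) (Fin n) 𝕜) :
    frobSq (B - M) = frobSq (B - symPart M) + frobSq (symPart M - M) := by
  have hN := isHermitian_symPart M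
  have h : frobInner (B - symPart M) (symPart M - M) = 0 := by
    refine frobInner_eq_zero_of_conjTranspose (by rw [conjTranspose_sub, hB.eq, hN.eq]) ?_
    rw [conjTranspose_sub, hN.eq, neg_sub, sub_eq_sub_iff_add_eq_add, symPart_add_symPart]
  rw [← sub_add_sub_cancel B (symPart M) M, frobSq_add, h]
  ring

theorem isFrobProj_symPart {n : ℕ} (M : Matrix (Fin n) (Fin n) 𝕜) :
    IsFrobProj {C : Matrix (Fin n) (Fin n) 𝕜 | C.IsHermitian} M (symPart M) := by
  refine ⟨isHermitian_symPart M, fun B hB hne => ?_⟩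
  rw [frobSq_sub_eq_symPart hB]
  have : 0 < frobSq (B - symPart M) := (frobSq_nonneg _).lt_of_ne fun h0 =>
    hne (sub_eq_zero.1 (frobSq_eq_zero h0.symm))
  linarith

/-- The matrix factors through `[Q, X*]`, which has `2k` columns. -/
theorem rank_symApprox_le {n k : ℕ} (Q : Matrix (Fin n) (Fin k) 𝕜) (X : Matrix (Fin k) (Fin n) 𝕜) :
    (symApprox Q X).rank ≤ 2 * k := by
  have h : symApprox Q X = fromCols Q Xᴴ * ((1 / 2 : 𝕜) • fromRows X Qᴴ) := by
    rw [Matrix.mul_smul, fromCols_mul_fromRows, symApprox, symPart, conjTranspose_mul]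
  rw [h]
  refine (rank_mul_le_left _ _).trans ((rank_le_card_width _).trans (le_of_eq ?_))
  rw [Fintype.card_sum, Fintype.card_fin, two_mul]

theorem mul_coreS_mul_eq {n k p : ℕ} {Q : Matrix (Fin n) (Fin k) 𝕜} {X : Matrix (Fin k) (Fin n) 𝕜}
    {U : Matrix (Fin n) (Fin p) 𝕜} {T : Matrix (Fin p) (Fin (k + k)) 𝕜}
    (h : concatQX Q X = U * T) : U * coreS T * Uᴴ = symApprox Q X := by
  have h1 : Q = U * T.submatrix id (Fin.castAdd k) := by
    ext i j
    have := congrFun (congrFun h i) (Fin.castAdd k j)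
    simpa [concatQX, mul_apply] using this
  have h2 : Xᴴ = U * T.submatrix id (Fin.natAdd k) := by
    ext i j
    exact (Fin.append_right (Q i) (Xᴴ i) j).symm.trans (congrFun (congrFun h i) (Fin.natAdd k j))
  have h3 : X = (T.submatrix id (Fin.natAdd k))ᴴ * Uᴴ := by
    rw [← conjTranspose_mul, ← h2, conjTranspose_conjTranspose]
  rw [symApprox, symPart, conjTranspose_mul, h2, h3]
  nth_rewrite 1 2 [h1]
  simp only [coreS, conjTranspose_mul, Matrix.mul_smul, Matrix.smul_mul, Matrix.mul_add,
    Matrix.add_mul, Matrix.mul_assoc]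

/-! ### The error of the approximation -/

section Error

variable {n k l : ℕ} {orth : Matrix (Fin n) (Fin k) 𝕜 → Matrix (Fin n) (Fin k) 𝕜}

/-- The approximation `Q X` with the explicit formula for the pseudoinverse. -/
noncomputable def sketchApprox (orth : Matrix (Fin n) (Fin k) 𝕜 → Matrix (Fin n) (Fin k) 𝕜)
    (A : Matrix (Fin n) (Fin n) 𝕜)
    (p : Matrix (Fin n) (Fin k) 𝕜 × Matrix (Fin l) (Fin n) 𝕜) : Matrix (Fin n) (Fin n) 𝕜 :=
  orth (A * p.1) * (gramPinv (p.2 * orth (A * p.1)) * (p.2 * A))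

theorem measurable_orth_mul (horth : Measurable orth) (A : Matrix (Fin n) (Fin n) 𝕜) :
    Measurable fun p : Matrix (Fin n) (Fin k) 𝕜 × Matrix (Fin l) (Fin n) 𝕜 => orth (A * p.1) := by
  have h1 : Measurable fun M : Matrix (Fin n) (Fin k) 𝕜 => A * M :=
    (continuous_const.matrix_mul continuous_id).measurable
  have h2 := (horth.comp h1).comp
    (measurable_fst : Measurable fun p : Matrix (Fin n) (Fin k) 𝕜 × Matrix (Fin l) (Fin n) 𝕜 => p.1)
  exact h2

theorem measurable_mul_orth (horth : Measurable orth) (A : Matrix (Fin n) (Fin n) 𝕜) :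
    Measurable fun p : Matrix (Fin n) (Fin k) 𝕜 × Matrix (Fin l) (Fin n) 𝕜 =>
      p.2 * orth (A * p.1) := by
  have h := measurable_matrix_mul.comp (measurable_snd.prodMk
    (measurable_orth_mul (l := l) horth A))
  exact h

theorem measurable_sketchApprox (horth : Measurable orth) (A : Matrix (Fin n) (Fin n) 𝕜) :
    Measurable (sketchApprox (l := l) orth A) := by
  have h1 : Measurable fun M : Matrix (Fin l) (Fin n) 𝕜 => M * A :=
    (continuous_id.matrix_mul continuous_const).measurable
  have h2 := h1.comp
    (measurable_snd : Measurable fun p : Matrix (Fin n) (Fin k) 𝕜 × Matrix (Fin l) (Fin n) 𝕜 => p.2)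
  have h3 := measurable_gramPinv.comp (measurable_mul_orth (l := l) horth A)
  have h4 := measurable_matrix_mul.comp (h3.prodMk h2)
  have h5 := measurable_matrix_mul.comp ((measurable_orth_mul (l := l) horth A).prodMk h4)
  exact h5

theorem measurable_frobSq_sub_sketchApprox (horth : Measurable orth)
    (A : Matrix (Fin n) (Fin n) 𝕜) :
    Measurable fun p => ENNReal.ofReal (frobSq (A - sketchApprox (l := l) orth A p)) := by
  have hc : Continuous fun M : Matrix (Fin n) (Fin n) 𝕜 => frobSq (A - M) :=
    continuous_frobSq.comp (continuous_const.sub continuous_id)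
  have h := (hc.measurable.comp (measurable_sketchApprox (l := l) horth A)).ennreal_ofReal
  exact h

theorem measurable_frobSq_sub_symPart_sketchApprox (horth : Measurable orth)
    (A : Matrix (Fin n) (Fin n) 𝕜) :
    Measurable fun p => frobSq (A - symPart (sketchApprox (l := l) orth A p)) := by
  have hc : Continuous fun M : Matrix (Fin n) (Fin n) 𝕜 => frobSq (A - symPart M) := by
    refine continuous_frobSq.comp (continuous_const.sub ?_)
    have h : Continuous fun M : Matrix (Fin n) (Fin n) 𝕜 => Mᴴ := continuous_id.matrix_conjTranspose
    exact (continuous_id.add h).const_smul (1 / 2 : 𝕜)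
  have h := hc.measurable.comp (measurable_sketchApprox (l := l) horth A)
  exact h

/-- By Fubini it suffices to freeze `Ω`; then `Q` is constant with orthonormal columns and `Ψ Q` is
again standard normal. -/
theorem ae_det_mul_orth_ne_zero (hl : k + alpha 𝕜 < l) (horth : Measurable orth)
    (ho : ∀ Y, (orth Y)ᴴ * orth Y = 1) (A : Matrix (Fin n) (Fin n) 𝕜) :
    ∀ᵐ p ∂(stdNormalLaw 𝕜 n k).prod (stdNormalLaw 𝕜 l n),
      ((p.2 * orth (A * p.1))ᴴ * (p.2 * orth (A * p.1))).det ≠ 0 := by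
  have hc : Continuous fun M : Matrix (Fin l) (Fin k) 𝕜 => (Mᴴ * M).det :=
    (continuous_id.matrix_conjTranspose.matrix_mul continuous_id).matrix_det
  have hm := hc.measurable.comp (measurable_mul_orth (l := l) horth A)
  have hset : MeasurableSet {p : Matrix (Fin n) (Fin k) 𝕜 × Matrix (Fin l) (Fin n) 𝕜 |
      ((p.2 * orth (A * p.1))ᴴ * (p.2 * orth (A * p.1))).det ≠ 0} :=
    (hm (measurableSet_singleton 0)).compl
  refine (Measure.ae_prod_iff_ae_ae hset).2 (ae_of_all _ fun om => ?_)
  have hmV : Measurable fun G : Matrix (Fin l) (Fin n) 𝕜 => G * orth (A * om) :=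
    (continuous_id.matrix_mul continuous_const).measurable
  have h := ae_det_ne_zero (𝕜 := 𝕜) hl
  rw [← map_mul_stdNormalLaw (ho (A * om))] at h
  exact ae_of_ae_map hmV.aemeasurable h

theorem lintegral_frobSq_sub_sketchApprox_le (hl : k + alpha 𝕜 < l) (horth : Measurable orth)
    (ho : ∀ Y, (orth Y)ᴴ * orth Y = 1) (A : Matrix (Fin n) (Fin n) 𝕜) :
    ∫⁻ p, ENNReal.ofReal (frobSq (A - sketchApprox orth A p))
        ∂(stdNormalLaw 𝕜 n k).prod (stdNormalLaw 𝕜 l n) ≤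
      ENNReal.ofReal (1 + fRatio 𝕜 k l) * ∫⁻ om, ENNReal.ofReal
        (frobSq (A - orth (A * om) * ((orth (A * om))ᴴ * A))) ∂stdNormalLaw 𝕜 n k := by
  have hf : 0 ≤ 1 + fRatio 𝕜 k l := by linarith [fRatio_nonneg hl]
  have hprod := lintegral_prod (μ := stdNormalLaw 𝕜 n k) (ν := stdNormalLaw 𝕜 l n) _
    (measurable_frobSq_sub_sketchApprox (l := l) horth A).aemeasurable
  rw [hprod, ← lintegral_const_mul' _ _ ENNReal.ofReal_ne_top]
  refine lintegral_mono fun om => ?_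
  have h := lintegral_frobSq_sub_oblique_le hl (ho (A * om)) A
  rw [ENNReal.ofReal_mul hf] at h
  exact h

end Error

theorem lintegral_range_error_le_tail {n k r : ℕ} (h : r + alpha 𝕜 < k)
    {orth : Matrix (Fin n) (Fin k) 𝕜 → Matrix (Fin n) (Fin k) 𝕜}
    (hqr : ∀ Y, ∃ R : Matrix (Fin k) (Fin k) 𝕜, IsQR Y (orth Y) R)
    (A : Matrix (Fin n) (Fin n) 𝕜) :
    ∫⁻ om, ENNReal.ofReal (frobSq (A - orth (A * om) * ((orth (A * om))ᴴ * A)))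
        ∂stdNormalLaw 𝕜 n k ≤
      ENNReal.ofReal ((1 + fRatio 𝕜 r k) * tailEnergySq (r + 1) A) := by
  set I := ∫⁻ om, ENNReal.ofReal (frobSq (A - orth (A * om) * ((orth (A * om))ᴴ * A)))
        ∂stdNormalLaw 𝕜 n k
  have hf : 0 < 1 + fRatio 𝕜 r k := by linarith [fRatio_nonneg (𝕜 := 𝕜) h]
  have hB : ∀ B : Matrix (Fin n) (Fin n) 𝕜, B.rank ≤ r →
      I ≤ ENNReal.ofReal ((1 + fRatio 𝕜 r k) * frobSq (A - B)) := by
    intro B hB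
    refine lintegral_range_finder_le h A B hB _ fun om Z => ?_
    obtain ⟨R, hR⟩ := hqr (A * om)
    -- `A Ω Z = Q (R Z)` lies in the range of `Q`, where `Q Q* A` is the best approximation.
    conv_rhs => rw [hR.factor, Matrix.mul_assoc]
    exact frobSq_sub_proj_le hR.orthonormal A (R * Z)
  have htop : I ≠ ⊤ := ((hB 0 (by simp)).trans_lt ENNReal.ofReal_lt_top).ne
  -- Finiteness allows passing to real numbers and dividing by the positive factor, so that the
  -- bound for every `B` gives the bound for the infimum without a minimiser.
  rw [← ENNReal.ofReal_toReal htop]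
  refine ENNReal.ofReal_le_ofReal ?_
  rw [mul_comm, ← div_le_iff₀ hf]
  refine le_csInf ⟨_, 0, by simp, rfl⟩ ?_
  rintro x ⟨B, hBr, rfl⟩
  rw [div_le_iff₀ hf, mul_comm]
  exact ENNReal.toReal_le_of_le_ofReal (mul_nonneg hf.le (frobSq_nonneg _))
    (hB B (Nat.lt_succ_iff.1 hBr))

theorem tailEnergySq_nonneg {m n : ℕ} (j : ℕ) (A : Matrix (Fin m) (Fin n) 𝕜) :
    0 ≤ tailEnergySq j A :=
  Real.sInf_nonneg fun _ ⟨_, _, hx⟩ => hx ▸ frobSq_nonneg _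

end LowRankSketch

/-! ### The main theorem. -/

theorem corollary5p2 {𝕜 : Type*} [RCLike 𝕜] {S : Type*} [MeasurableSpace S] (P : Measure S)
    [IsProbabilityMeasure P] (n k l : ℕ) (hl : k + alpha 𝕜 < l)
    (A : Matrix (Fin n) (Fin n) 𝕜) (hA : A.IsHermitian)
    -- the test matrices
    (Om : S → Matrix (Fin n) (Fin k) 𝕜) (Psi : S → Matrix (Fin l) (Fin n) 𝕜)
    (hOm : IsStdNormal Om P) (hPsi : IsStdNormal Psi P) (hind : IndepFun Om Psi P)
    -- any measurable procedure that returns the orthonormal factor of a QR factorization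
    (orth : Matrix (Fin n) (Fin k) 𝕜 → Matrix (Fin n) (Fin k) 𝕜) (horth : Measurable orth)
    (hqr : ∀ Y, ∃ R : Matrix (Fin k) (Fin k) 𝕜, IsQR Y (orth Y) R)
    -- the factors of the initial approximation, and the symmetric approximation
    (Q : S → Matrix (Fin n) (Fin k) 𝕜) (hQ : ∀ s, Q s = orth (A * Om s))
    (X : S → Matrix (Fin k) (Fin n) 𝕜) (hX : ∀ s, X s = factorX (Q s) (Psi s) (Psi s * A))
    (Asym : S → Matrix (Fin n) (Fin n) 𝕜) (hAsym : ∀ s, Asym s = symApprox (Q s) (X s)) :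
    -- it is the projection of `Q X` onto the conjugate symmetric matrices, has rank at most `2k`,
    -- and agrees with the factored form `U S U*`
    (∀ s, IsFrobProj {C : Matrix (Fin n) (Fin n) 𝕜 | C.IsHermitian} (Q s * X s) (Asym s) ∧
      (Asym s).rank ≤ 2 * k ∧
      ∀ (p : ℕ) (U : Matrix (Fin n) (Fin p) 𝕜) (T : Matrix (Fin p) (Fin (k + k)) 𝕜),
        IsQR (concatQX (Q s) (X s)) U T → U * coreS T * Uᴴ = Asym s) ∧
    -- the expected squared error
    Integrable (fun s => frobSq (A - Asym s)) P ∧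
    ∀ hk : alpha 𝕜 < k,
      ∫ s, frobSq (A - Asym s) ∂P ≤
        (1 + fRatio 𝕜 k l) *
          (Finset.range (k - alpha 𝕜)).inf'
            (Finset.nonempty_range_iff.2 (Nat.sub_ne_zero_of_lt hk))
            (fun r => (1 + fRatio 𝕜 r k) * tailEnergySq (r + 1) A) := by
  refine ⟨fun s => ⟨?_, ?_, fun p U T h => ?_⟩, ?_⟩
  · rw [hAsym]; exact isFrobProj_symPart _
  · rw [hAsym]; exact rank_symApprox_le _ _
  · rw [hAsym]; exact mul_coreS_mul_eq h.factor
  have ho : ∀ Y, (orth Y)ᴴ * orth Y = 1 := fun Y => (hqr Y).choose_spec.orthonormal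
  have hf : 0 ≤ 1 + fRatio 𝕜 k l := by linarith [fRatio_nonneg hl]
  obtain ⟨mOm, lOm⟩ := hOm.aemeasurable_map_eq
  obtain ⟨mPsi, lPsi⟩ := hPsi.aemeasurable_map_eq
  have mpair : AEMeasurable (fun s => (Om s, Psi s)) P := mOm.prodMk mPsi
  have hlaw : P.map (fun s => (Om s, Psi s)) =
      (stdNormalLaw 𝕜 n k).prod (stdNormalLaw 𝕜 l n) := by
    rw [(indepFun_iff_map_prod_eq_prod_map_map mOm mPsi).1 hind, lOm, lPsi]
  -- `pinv` agrees with the measurable explicit formula off a null set, which suffices for all the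
  -- integrals.
  have hae : ∀ᵐ s ∂P, Asym s = symPart (sketchApprox orth A (Om s, Psi s)) := by
    have h := ae_det_mul_orth_ne_zero hl horth ho A
    rw [← hlaw] at h
    filter_upwards [ae_of_ae_map mpair h] with s hs
    rw [hAsym, hX, hQ, symApprox, factorX, pinv_eq_gramPinv hs, sketchApprox]
  set I := ∫⁻ om, ENNReal.ofReal (frobSq (A - orth (A * om) * ((orth (A * om))ᴴ * A)))
    ∂stdNormalLaw 𝕜 n k
  have hbound : ∫⁻ s, ENNReal.ofReal (frobSq (A - Asym s)) ∂P ≤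
      ENNReal.ofReal (1 + fRatio 𝕜 k l) * I := by
    calc _ ≤ ∫⁻ s, ENNReal.ofReal (frobSq (A - sketchApprox orth A (Om s, Psi s))) ∂P := by
          refine lintegral_mono_ae ?_
          filter_upwards [hae] with s hs
          refine ENNReal.ofReal_le_ofReal ?_
          rw [hs, frobSq_sub_eq_symPart hA (sketchApprox orth A (Om s, Psi s))]
          linarith [frobSq_nonneg (symPart (sketchApprox orth A (Om s, Psi s)) -
            sketchApprox orth A (Om s, Psi s))]
      _ = ∫⁻ p, ENNReal.ofReal (frobSq (A - sketchApprox orth A p))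
            ∂(stdNormalLaw 𝕜 n k).prod (stdNormalLaw 𝕜 l n) := by
          rw [← hlaw, lintegral_map' (measurable_frobSq_sub_sketchApprox horth A).aemeasurable
            mpair]
      _ ≤ _ := lintegral_frobSq_sub_sketchApprox_le hl horth ho A
  -- A projection residual never exceeds `‖A‖²`, so integrability needs no assumption `k > α`.
  have hItop : I < ⊤ := by
    refine lt_of_le_of_lt (b := ∫⁻ _, ENNReal.ofReal (frobSq A) ∂stdNormalLaw 𝕜 n k)
      (lintegral_mono fun om => ENNReal.ofReal_le_ofReal ?_) (by simp)
    simpa using frobSq_sub_proj_le (ho (A * om)) A 0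
  have hmeas : AEStronglyMeasurable (fun s => frobSq (A - Asym s)) P := by
    have h := (measurable_frobSq_sub_symPart_sketchApprox (l := l) horth A).comp_aemeasurable mpair
    refine h.aestronglyMeasurable.congr ?_
    filter_upwards [hae] with s hs
    rw [hs]
    rfl
  have hint : Integrable (fun s => frobSq (A - Asym s)) P := by
    refine ⟨hmeas, ?_⟩
    rw [hasFiniteIntegral_iff_ofReal (ae_of_all _ fun _ => frobSq_nonneg _)]
    exact hbound.trans_lt (ENNReal.mul_lt_top ENNReal.ofReal_lt_top hItop)
  refine ⟨hint, fun hk => ?_⟩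
  obtain ⟨r, hr, hmin⟩ := Finset.exists_mem_eq_inf'
    (Finset.nonempty_range_iff.2 (Nat.sub_ne_zero_of_lt hk))
    (fun r => (1 + fRatio 𝕜 r k) * tailEnergySq (r + 1) A)
  rw [hmin]
  have hrk : r + alpha 𝕜 < k := by
    have := Finset.mem_range.1 hr
    omega
  have hr0 : 0 ≤ (1 + fRatio 𝕜 r k) * tailEnergySq (r + 1) A :=
    mul_nonneg (by linarith [fRatio_nonneg (𝕜 := 𝕜) hrk]) (tailEnergySq_nonneg _ _)
  rw [← ENNReal.ofReal_le_ofReal_iff (mul_nonneg hf hr0),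
    ofReal_integral_eq_lintegral_ofReal hint (ae_of_all _ fun _ => frobSq_nonneg _),
    ENNReal.ofReal_mul hf]
  refine hbound.trans ?_
  gcongr
  exact lintegral_range_error_le_tail hrk hqr A
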